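/- Let $q=2^r$ ($r\ge 1$), let $\mathrm{tr}(x)=x+x^2+\cdots+x^{2^{r-1}}$ be the trace $\mathbb{F}_q\to\mathbb{F}_2$, let $\lambda(x)=(-1)^{\mathrm{tr}(x)}$, and for $a\in\mathbb{F}_q^*$ let $K(\lambda;a)=\sum_{\alpha\in\mathbb{F}_q^*}\lambda(\alpha+a\alpha^{-1})$. For $n\ge 1$ let $$P^+=P^+(2n,q)=\left\{\begin{bmatrix}A&0\\0&{}^tA^{-1}\end{bmatrix}\begin{bmatrix}1_n&B\\0&1_n\end{bmatrix} : A\in GL(n,q),\ B \text{ an alternating } n\times n \text{ matrix}\right\}$$ and, for $0\le k\le n$, $$\sigma_k^+=\begin{bmatrix}0&0&1_k&0\\0&1_{n-k}&0&0\\1_k&0&0&0\\0&0&0&1_{n-k}\end{bmatrix}.$$ Put $DC_1^{\pm}(n,q)=P^+\sigma_{n-1}^+P^+$ and $DC_2^{\pm}(n,q)=P^+\sigma_{n-2}^+P^+$, where the sign is $+$ for $n$ even and $-$ for $n$ odd; $n\ge 2$ for $DC_1^+$ and $DC_2^+$, $n\ge 1$ for $DC_1^-$, and $n\ge 3$ for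 $DC_2^-$. For $\beta\in\mathbb{F}_q$ let $N_{DC_i^\pm(n,q)}(\beta)$ be the number of $w\in DC_i^\pm(n,q)$ with matrix trace $\beta$. With ${n\brack k}_q=\prod_{j=0}^{k-1}\frac{q^{n-j}-1}{q^{k-j}-1}$, put $$A_1^+=q^{\frac14(5n^2-6n)}{n\brack 1}_q\prod_{j=1}^{n/2}(q^{2j-1}-1),\qquad B_1^+=q^{\frac14(n-2)^2}\prod_{j=1}^{n/2}(q^{2j}-1),$$ $$A_2^+=q^{\frac14(5n^2-6n)}{n\brack 2}_q\prod_{j=1}^{(n-2)/2}(q^{2j-1}-1),\qquad B_2^+=q^{\frac14(n^2-8n+12)}(q^{n-1}-1)(q^n-1)\prod_{j=1}^{(n-2)/2}(q^{2j}-1),$$ $$A_1^-=q^{\frac14(5n^2-4n-1)}{n\brack 1}_q\prod_{j=1}^{(n-1)/2}(q^{2j-1}-1),\qquad B_1^-=q^{\frac14(n^2-6n+5)}(q^n-1)\prod_{j=1}^{(n-1)/2}(q^{2j}-1),$$ $$A_2^-=q^{\frac14(5n^2-8n+3)}{n\brack 2}_q\prod_{j=1}^{(n-1)/2}(q^{2j-1}-1),\qquad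 B_2^-=q^{\frac14(n-3)^2}(q^n-1)\prod_{j=1}^{(n-1)/2}(q^{2j}-1).$$ Then for all these $n$, all $q$ and all $\beta\in\mathbb{F}_q$: (a) $$N_{DC_1^\pm(n,q)}(\beta)=q^{-1}A_1^\pm B_1^\pm+q^{-1}A_1^\pm\times\begin{cases}1,&\beta=0,\\ q+1,&\beta\ne0,\ \mathrm{tr}(\beta^{-1})=0,\\ -q+1,&\beta\ne0,\ \mathrm{tr}(\beta^{-1})=1;\end{cases}$$ (b) $$N_{DC_2^\pm(n,q)}(\beta)=q^{-1}A_2^\pm B_2^\pm+q^{-1}A_2^\pm\times\begin{cases}qK(\lambda;\beta^{-1})-q^2-1,&\beta\ne0,\\ q^3-q^2-1,&\beta=0.\end{cases}$$ -/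

import Mathlib

open scoped Matrix

/-- An `n × n` matrix is alternating if its diagonal vanishes and `B i j = - B j i`. -/
def IsAlternating {F : Type*} [Field F] {n : ℕ} (B : Matrix (Fin n) (Fin n) F) : Prop :=
  (∀ i, B i i = 0) ∧ ∀ i j, B i j = -B j i

/-- The maximal parabolic subgroup `P⁺(2n,q)` of `O⁺(2n,q)`, as a set of `2n × 2n` matrices
(rows and columns indexed by `Fin n ⊕ Fin n`): all products
`[A 0; 0 ᵗA⁻¹] [1 B; 0 1]` with `A` invertible and `B` alternating. -/
def parabolic (F : Type*) [Field F] (n : ℕ) : Set (Matrix (Fin n ⊕ Fin n) (Fin n ⊕ Fin n) F) :=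
  {w | ∃ A B : Matrix (Fin n) (Fin n) F, IsUnit A.det ∧ IsAlternating B ∧
    w = Matrix.fromBlocks A 0 0 (A⁻¹)ᵀ * Matrix.fromBlocks 1 B 0 1}

/-- The `n × n` diagonal matrix `diag(1_k, 0_{n-k})`. -/
def headProj (F : Type*) [Field F] (n k : ℕ) : Matrix (Fin n) (Fin n) F :=
  Matrix.diagonal fun i => if (i : ℕ) < k then 1 else 0

/-- The `n × n` diagonal matrix `diag(0_k, 1_{n-k})`. -/
def tailProj (F : Type*) [Field F] (n k : ℕ) : Matrix (Fin n) (Fin n) F :=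
  Matrix.diagonal fun i => if (i : ℕ) < k then 0 else 1

/-- The matrix `σ_k⁺ = [0 0 1_k 0; 0 1_{n-k} 0 0; 1_k 0 0 0; 0 0 0 1_{n-k}]`. -/
def sigmaPlus (F : Type*) [Field F] (n k : ℕ) :
    Matrix (Fin n ⊕ Fin n) (Fin n ⊕ Fin n) F :=
  Matrix.fromBlocks (tailProj F n k) (headProj F n k) (headProj F n k) (tailProj F n k)

/-- The double coset `P⁺ σ_{n-1}⁺ P⁺`; it is `DC₁⁺(n,q)` for `n` even (`n ≥ 2`) and
`DC₁⁻(n,q)` for `n` odd (`n ≥ 1`). -/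
def DC1 (F : Type*) [Field F] (n : ℕ) : Set (Matrix (Fin n ⊕ Fin n) (Fin n ⊕ Fin n) F) :=
  DoubleCoset.doubleCoset (sigmaPlus F n (n - 1)) (parabolic F n) (parabolic F n)

/-- The double coset `P⁺ σ_{n-2}⁺ P⁺`; it is `DC₂⁺(n,q)` for `n` even (`n ≥ 2`) and
`DC₂⁻(n,q)` for `n` odd (`n ≥ 3`). -/
def DC2 (F : Type*) [Field F] (n : ℕ) : Set (Matrix (Fin n ⊕ Fin n) (Fin n ⊕ Fin n) F) :=
  DoubleCoset.doubleCoset (sigmaPlus F n (n - 2)) (parabolic F n) (parabolic F n)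

/-- `N_D(β)`: the number of elements of `D` with matrix trace `β`. -/
noncomputable def traceCount {F : Type*} [Field F] {n : ℕ}
    (D : Set (Matrix (Fin n ⊕ Fin n) (Fin n ⊕ Fin n) F)) (β : F) : ℕ :=
  {w | w ∈ D ∧ w.trace = β}.ncard

/-- The trace function `tr : 𝔽_q → 𝔽₂`, `x ↦ x + x² + ⋯ + x^(q/2)`. -/
noncomputable def absTrace {F : Type*} [Field F] [Algebra (ZMod 2) F] (x : F) : ZMod 2 :=
  Algebra.trace (ZMod 2) F x

/-- The canonical additive character `λ(x) = (-1)^tr(x)`. -/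
noncomputable def canonicalChar {F : Type*} [Field F] [Algebra (ZMod 2) F] (x : F) : ℤ :=
  (-1) ^ (absTrace x).val

/-- The Kloosterman sum `K(λ; a) = ∑_{α ∈ 𝔽_q^*} λ(α + a α⁻¹)`. -/
noncomputable def kloosterman {F : Type*} [Field F] [Fintype F] [Algebra (ZMod 2) F]
    (a : F) : ℤ :=
  open scoped Classical in ∑ α : Fˣ, canonicalChar ((α : F) + a * (α : F)⁻¹)

/-- The `q`-binomial coefficient `∏_{j=0}^{k-1} (q^{n-j} - 1) / (q^{k-j} - 1)`. -/
def qBinomial (q : ℚ) (n k : ℕ) : ℚ :=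
  ∏ j ∈ Finset.range k, (q ^ (n - j) - 1) / (q ^ (k - j) - 1)

/-! In the following, the exponents of `q` are integers (possibly negative): the divisions by `4`
are exact, for even `n` in the `Plus` versions and for odd `n` in the `Minus` versions. -/

def A1Plus (n : ℕ) (q : ℚ) : ℚ :=
  q ^ ((5 * (n : ℤ) ^ 2 - 6 * n) / 4) * qBinomial q n 1 *
    ∏ j ∈ Finset.Icc 1 (n / 2), (q ^ (2 * j - 1) - 1)

def B1Plus (n : ℕ) (q : ℚ) : ℚ :=
  q ^ (((n : ℤ) - 2) ^ 2 / 4) * ∏ j ∈ Finset.Icc 1 (n / 2), (q ^ (2 * j) - 1)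

def A2Plus (n : ℕ) (q : ℚ) : ℚ :=
  q ^ ((5 * (n : ℤ) ^ 2 - 6 * n) / 4) * qBinomial q n 2 *
    ∏ j ∈ Finset.Icc 1 ((n - 2) / 2), (q ^ (2 * j - 1) - 1)

def B2Plus (n : ℕ) (q : ℚ) : ℚ :=
  q ^ (((n : ℤ) ^ 2 - 8 * n + 12) / 4) * (q ^ (n - 1) - 1) * (q ^ n - 1) *
    ∏ j ∈ Finset.Icc 1 ((n - 2) / 2), (q ^ (2 * j) - 1)

def A1Minus (n : ℕ) (q : ℚ) : ℚ :=
  q ^ ((5 * (n : ℤ) ^ 2 - 4 * n - 1) / 4) * qBinomial q n 1 *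
    ∏ j ∈ Finset.Icc 1 ((n - 1) / 2), (q ^ (2 * j - 1) - 1)

def B1Minus (n : ℕ) (q : ℚ) : ℚ :=
  q ^ (((n : ℤ) ^ 2 - 6 * n + 5) / 4) * (q ^ n - 1) *
    ∏ j ∈ Finset.Icc 1 ((n - 1) / 2), (q ^ (2 * j) - 1)

def A2Minus (n : ℕ) (q : ℚ) : ℚ :=
  q ^ ((5 * (n : ℤ) ^ 2 - 8 * n + 3) / 4) * qBinomial q n 2 *
    ∏ j ∈ Finset.Icc 1 ((n - 1) / 2), (q ^ (2 * j - 1) - 1)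

def B2Minus (n : ℕ) (q : ℚ) : ℚ :=
  q ^ (((n : ℤ) - 3) ^ 2 / 4) * (q ^ n - 1) *
    ∏ j ∈ Finset.Icc 1 ((n - 1) / 2), (q ^ (2 * j) - 1)

/-- The formula for `i = 1`, for given values of `A` and `B`. -/
def TraceFormula1 {F : Type*} [Field F] [Algebra (ZMod 2) F] (q A B : ℚ) (N : F → ℕ) : Prop :=
  (N 0 : ℚ) = q⁻¹ * A * B + q⁻¹ * A * 1 ∧
  ∀ β : F, β ≠ 0 →
    (absTrace β⁻¹ = 0 → (N β : ℚ) = q⁻¹ * A * B + q⁻¹ * A * (q + 1)) ∧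
    (absTrace β⁻¹ = 1 → (N β : ℚ) = q⁻¹ * A * B + q⁻¹ * A * (-q + 1))

/-- The formula for `i = 2`, for given values of `A` and `B`. -/
def TraceFormula2 {F : Type*} [Field F] [Fintype F] [Algebra (ZMod 2) F] (q A B : ℚ)
    (N : F → ℕ) : Prop :=
  (∀ β : F, β ≠ 0 →
    (N β : ℚ) = q⁻¹ * A * B + q⁻¹ * A * (q * (kloosterman β⁻¹ : ℚ) - q ^ 2 - 1)) ∧
  (N 0 : ℚ) = q⁻¹ * A * B + q⁻¹ * A * (q ^ 3 - q ^ 2 - 1)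

/-! The pairs `(x, y)` in `P × P` with `tr (x σ y) = β` can be counted in two ways. Each element of
`P σ P` has `|P ∩ σ P σ|` factorisations; on the other hand `tr (x σ y) = tr (y x σ)`, and for fixed
`y` the product `y x` runs over `P`. So the theorem rests on the distribution of `tr (p σ)` for `p`
in `P` (`ncard_doubleCoset_fiber`).

Let `n = r + m`, `σ = σ_r`, `H = diag(1_r, 0)`, and let `p` have Levi part `A` and unipotent part
`B`. Then `tr (p σ)` is a term depending only on `A` plus `tr (H A B)`. As `B` runs over the
alternating matrices, the second term takes every value equally often, unless `H A` is symmetric,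
when it vanishes identically (`trace_mul_alternating_eq_zero_iff`). In the exceptional case `A = [a
0; c d]` with `a` symmetric, and what remains is `tr d + tr d⁻¹` with `d` in `GL_m`. If all `A`
behaved uniformly the count would not depend on `β`; this is the term `q⁻¹ A B` of the formula. The
exceptional `A` add a deviation proportional to the number of invertible symmetric `r × r` matrices
times `q g(β) - |GL_m|`, where `g(β)` counts the `d` with `tr d + tr d⁻¹ = β` (`traceCount_mul`).

Invertible symmetric matrices are counted by a two-step recursion on the size
(`symmetricCount_add_two`). Characteristic two enters only in `g(β)` for `m = 1, 2`, through the
fact that `u² + u = c` has `1 + λ(c)` solutions (`ncard_sq_add_self`). For `m = 1` the equation `x +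
x⁻¹ = β` with `β ≠ 0` takes this form. For `m = 2` one has `tr d⁻¹ = tr d / det d`, so a determinant
other than `1` fixes the trace; the number of matrices with given trace and determinant is a
character value up to elementary terms, and summing over determinants produces the Kloosterman sum
(`traceAddInvCount_two_of_ne_zero`). -/

/-! ### Counting a double coset by a class function -/

section DoubleCosetCount

variable {M X : Type*} [Monoid M]

/-- Two factorisations through `P × P`: if `σ` is an involution, the number of elements of
`P σ P` in a fibre of a class function is determined by the number of `p ∈ P` with `p σ` in
that fibre. -/
theorem ncard_doubleCoset_fiber (P : Set M) (hmul : ∀ x ∈ P, ∀ y ∈ P, x * y ∈ P)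
    (inv : M → M) (hinv : ∀ x ∈ P, inv x ∈ P ∧ x * inv x = 1 ∧ inv x * x = 1)
    (σ : M) (hσ : σ * σ = 1) (f : M → X) (hf : ∀ x y, f (x * y) = f (y * x)) (b : X) :
    {w | w ∈ DoubleCoset.doubleCoset σ P P ∧ f w = b}.ncard *
      {p | p ∈ P ∧ σ * p * σ ∈ P}.ncard = P.ncard * {p | p ∈ P ∧ f (p * σ) = b}.ncard := by
  classical
  have key : ∀ w ∈ DoubleCoset.doubleCoset σ P P, ∃ x : M × M,
      x.1 ∈ P ∧ x.2 ∈ P ∧ w = x.1 * σ * x.2 := by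
    intro w hw
    obtain ⟨x, hx, y, hy, h⟩ := DoubleCoset.mem_doubleCoset.1 hw
    exact ⟨(x, y), hx, hy, h⟩
  choose! c hc1 hc2 hc3 using key
  rw [← Set.ncard_prod, ← Set.ncard_prod]
  -- Both products count the pairs `(x, y)` with `x σ y` in the fibre.
  trans {z : M × M | z.1 ∈ P ∧ z.2 ∈ P ∧ f (z.1 * σ * z.2) = b}.ncard
  · symm
    -- A factorisation `w = x σ y` is compared with the chosen one `w = a σ d`; the two differ by `u
    -- = a⁻¹ x`, and `σ u σ = d y⁻¹` puts `u` in the stabiliser.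
    refine Set.ncard_congr (fun z _ => (z.1 * σ * z.2, inv (c (z.1 * σ * z.2)).1 * z.1)) ?_ ?_ ?_
    · rintro ⟨x, y⟩ ⟨hx, hy, hb⟩
      have hw : x * σ * y ∈ DoubleCoset.doubleCoset σ P P :=
        DoubleCoset.mem_doubleCoset.2 ⟨x, hx, y, hy, rfl⟩
      refine ⟨⟨hw, hb⟩, hmul _ (hinv _ (hc1 _ hw)).1 _ hx, ?_⟩
      have h3 := hc3 _ hw
      dsimp only at h3 hx hy ⊢
      have h1 := hinv _ (hc1 _ hw)
      have h2 := hinv _ hy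
      set a := (c (x * σ * y)).1
      set d := (c (x * σ * y)).2
      have : σ * (inv a * x) * σ = d * inv y := by
        calc σ * (inv a * x) * σ = σ * inv a * (x * σ * y) * inv y := by
              simp only [mul_assoc, h2.2.1, mul_one]
          _ = σ * (inv a * a) * σ * d * inv y := by rw [h3]; simp only [mul_assoc]
          _ = d * inv y := by rw [h1.2.2, mul_one, hσ, one_mul]
      rw [this]
      exact hmul _ (hc2 _ hw) _ h2.1
    · rintro ⟨x, y⟩ ⟨x', y'⟩ ⟨hx, hy, hb⟩ ⟨hx', hy', hb'⟩ h
      dsimp only at hx hy hx' hy'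
      simp only [Prod.mk.injEq] at h
      obtain ⟨h1, h2⟩ := h
      have hw : x * σ * y ∈ DoubleCoset.doubleCoset σ P P :=
        DoubleCoset.mem_doubleCoset.2 ⟨x, hx, y, hy, rfl⟩
      rw [← h1] at h2
      have h3 := hinv _ (hc1 _ hw)
      have hxx : x = x' := by
        have := congrArg (fun t => (c (x * σ * y)).1 * t) h2
        simpa only [← mul_assoc, h3.2.1, one_mul] using this
      subst hxx
      have h4 := hinv _ hx
      have := congrArg (fun t => σ * (inv x * t)) h1
      simp only [mul_assoc] at this
      rw [← mul_assoc (inv x), ← mul_assoc (inv x), h4.2.2, one_mul, one_mul, ← mul_assoc,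
        ← mul_assoc, hσ, one_mul, one_mul] at this
      rw [this]
    · rintro ⟨w, u⟩ ⟨⟨hw, hb⟩, hu, hu'⟩
      dsimp only at hw hu hu' hb
      have h1 := hc3 _ hw
      have h2 := hinv _ hu
      have h3 := hinv _ hu'
      have h4 := hinv _ (hc1 _ hw)
      have hw' : (c w).1 * u * σ * (inv (σ * u * σ) * (c w).2) = w := by
        have : u * σ = σ * (σ * u * σ) := by
          simp only [← mul_assoc, hσ, one_mul]
        rw [mul_assoc (c w).1, this]
        rw [mul_assoc (c w).1, mul_assoc σ, ← mul_assoc (σ * u * σ), h3.2.1, one_mul,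
          ← mul_assoc, ← h1]
      refine ⟨((c w).1 * u, inv (σ * u * σ) * (c w).2),
        ⟨hmul _ (hc1 _ hw) _ hu, hmul _ h3.1 _ (hc2 _ hw), ?_⟩, ?_⟩
      · dsimp only
        rw [hw', hb]
      · dsimp only
        rw [hw', ← mul_assoc, h4.2.2, one_mul]
  -- Cyclic invariance of `f` turns `x σ y` into `(y x) σ`.
  · refine Set.ncard_congr (fun z _ => (z.2, z.2 * z.1)) ?_ ?_ ?_
    · rintro ⟨x, y⟩ ⟨hx, hy, hb⟩
      refine ⟨hy, hmul _ hy _ hx, ?_⟩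
      dsimp only at hb ⊢
      rw [mul_assoc, hf, ← hb]
    · rintro ⟨x, y⟩ ⟨x', y'⟩ ⟨hx, hy, hb⟩ ⟨hx', hy', hb'⟩ h
      simp only [Prod.mk.injEq] at h
      obtain ⟨rfl, h2⟩ := h
      have := congrArg (fun t => inv y * t) h2
      simp only [← mul_assoc, (hinv _ hy).2.2, one_mul] at this
      rw [this]
    · rintro ⟨y, z⟩ ⟨hy, hz, hb⟩
      dsimp only at hy hz hb
      have h := hinv _ hy
      have h' : y * (inv y * z) = z := by rw [← mul_assoc, h.2.1, one_mul]
      refine ⟨(inv y * z, y), ⟨hmul _ h.1 _ hz, hy, ?_⟩, ?_⟩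
      · dsimp only
        rw [hf, ← mul_assoc, h', hb]
      · dsimp only
        rw [h']

end DoubleCosetCount

/-! ### Alternating matrices -/

section Alternating

variable (F ι : Type*) [Field F]

/-- The space of alternating matrices with arbitrary index type. -/
def alternatingMatrices : Submodule F (Matrix ι ι F) where
  carrier := {B | (∀ i, B i i = 0) ∧ ∀ i j, B i j = -B j i}
  add_mem' := by
    rintro A B ⟨h1, h2⟩ ⟨h3, h4⟩
    refine ⟨fun i => by simp [h1, h3], fun i j => ?_⟩
    rw [Matrix.add_apply, Matrix.add_apply, h2, h4]; ring
  zero_mem' := by simp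
  smul_mem' := by
    rintro c A ⟨h1, h2⟩
    refine ⟨fun i => by simp [h1], fun i j => ?_⟩
    rw [Matrix.smul_apply, Matrix.smul_apply, h2, smul_neg]

variable {F ι}

theorem mem_alternatingMatrices {B : Matrix ι ι F} :
    B ∈ alternatingMatrices F ι ↔ (∀ i, B i i = 0) ∧ ∀ i j, B i j = -B j i := Iff.rfl

theorem sub_transpose_mem_alternatingMatrices (C : Matrix ι ι F) :
    C - Cᵀ ∈ alternatingMatrices F ι := by
  refine ⟨fun i => by simp, fun i j => by simp⟩

/-- The part of `B` above the diagonal, for any linear order on the indices, serves as `C`. In this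
form the zero diagonal, which skew-symmetry does not give in characteristic two, needs no separate
care. -/
theorem exists_eq_sub_transpose {B : Matrix ι ι F} (hB : B ∈ alternatingMatrices F ι) :
    ∃ C, B = C - Cᵀ := by
  classical
  let _ : LinearOrder ι := IsWellOrder.linearOrder (WellOrderingRel (α := ι))
  refine ⟨Matrix.of fun i j => if i < j then B i j else 0, ?_⟩
  ext i j
  rcases lt_trichotomy i j with h | rfl | h
  · simp [h, h.not_gt]
  · simp [hB.1]
  · simp [h, h.not_gt, hB.2 i j]

theorem transpose_mem_alternatingMatrices {B : Matrix ι ι F}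
    (hB : B ∈ alternatingMatrices F ι) : Bᵀ ∈ alternatingMatrices F ι :=
  ⟨fun i => hB.1 i, fun i j => hB.2 j i⟩

theorem congr_mem_alternatingMatrices [Fintype ι] {κ : Type*} (X : Matrix κ ι F)
    {B : Matrix ι ι F} (hB : B ∈ alternatingMatrices F ι) :
    X * B * Xᵀ ∈ alternatingMatrices F κ := by
  obtain ⟨C, rfl⟩ := exists_eq_sub_transpose hB
  convert sub_transpose_mem_alternatingMatrices (X * C * Xᵀ) using 1
  simp [Matrix.mul_sub, Matrix.sub_mul, Matrix.transpose_mul, Matrix.mul_assoc]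

end Alternating

/-! ### The parabolic subgroup inside the orthogonal group -/

section Parabolic

theorem fromBlocks_sub_fromBlocks {R l m n o : Type*} [AddGroup R] (a a' : Matrix n l R)
    (b b' : Matrix n m R) (c c' : Matrix o l R) (d d' : Matrix o m R) :
    Matrix.fromBlocks a b c d - Matrix.fromBlocks a' b' c' d' =
      Matrix.fromBlocks (a - a') (b - b') (c - c') (d - d') := by
  ext (i | i) (j | j) <;> rfl

variable {F : Type*} [Field F]

/-- The Gram matrix of the hyperbolic quadratic form `∑ xᵢ yᵢ`. -/
def hyperbolicGram (F : Type*) [Field F] (n : ℕ) :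
    Matrix (Fin n ⊕ Fin n) (Fin n ⊕ Fin n) F :=
  Matrix.fromBlocks 0 1 0 0

/-- A matrix preserves the hyperbolic quadratic form. -/
def PreservesHyperbolic {n : ℕ} (w : Matrix (Fin n ⊕ Fin n) (Fin n ⊕ Fin n) F) : Prop :=
  wᵀ * hyperbolicGram F n * w - hyperbolicGram F n ∈ alternatingMatrices F (Fin n ⊕ Fin n)

variable {n : ℕ}

/-- With `G` the Gram matrix, the defect of `w v` is `vᵀ (wᵀ G w - G) v` plus the defect of `v`.
Working modulo alternating matrices expresses equality of quadratic forms in every characteristic.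
-/
theorem PreservesHyperbolic.mul {w v : Matrix (Fin n ⊕ Fin n) (Fin n ⊕ Fin n) F}
    (hw : PreservesHyperbolic w) (hv : PreservesHyperbolic v) :
    PreservesHyperbolic (w * v) := by
  have h := Submodule.add_mem _ (congr_mem_alternatingMatrices vᵀ hw) hv
  unfold PreservesHyperbolic
  convert h using 1
  simp only [Matrix.mul_sub, Matrix.sub_mul, Matrix.transpose_mul, Matrix.mul_assoc,
    Matrix.transpose_transpose]
  abel

theorem preservesHyperbolic_fromBlocks_zero₂₁ (a b d : Matrix (Fin n) (Fin n) F) :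
    PreservesHyperbolic (Matrix.fromBlocks a b 0 d) ↔
      aᵀ * d = 1 ∧ bᵀ * d ∈ alternatingMatrices F (Fin n) := by
  have h : (Matrix.fromBlocks a b 0 d)ᵀ * hyperbolicGram F n * Matrix.fromBlocks a b 0 d -
      hyperbolicGram F n = Matrix.fromBlocks 0 (aᵀ * d - 1) 0 (bᵀ * d) := by
    simp [hyperbolicGram, Matrix.fromBlocks_transpose, Matrix.fromBlocks_multiply,
      fromBlocks_sub_fromBlocks]
  unfold PreservesHyperbolic
  rw [h]
  constructor
  · rintro ⟨h1, h2⟩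
    refine ⟨?_, fun i => by simpa using h1 (Sum.inr i),
      fun i j => by simpa using h2 (Sum.inr i) (Sum.inr j)⟩
    rw [← sub_eq_zero]
    ext i j
    simpa using h2 (Sum.inl i) (Sum.inr j)
  · rintro ⟨h1, h2⟩
    rw [h1, sub_self]
    refine ⟨?_, ?_⟩
    · rintro (i | i)
      · simp
      · simpa using h2.1 i
    · rintro (i | i) (j | j)
      · simp
      · simp
      · simp
      · simpa using h2.2 i j

/-- The element of the parabolic subgroup with Levi part `A` and unipotent part `B`. -/
noncomputable def parabolicElement (x : Matrix (Fin n) (Fin n) F × Matrix (Fin n) (Fin n) F) :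
    Matrix (Fin n ⊕ Fin n) (Fin n ⊕ Fin n) F :=
  Matrix.fromBlocks x.1 (x.1 * x.2) 0 (x.1⁻¹)ᵀ

theorem parabolic_eq_image : parabolic F n = parabolicElement ''
    ({A | IsUnit A.det} ×ˢ (alternatingMatrices F (Fin n) : Set _)) := by
  ext w
  constructor
  · rintro ⟨A, B, hA, hB, rfl⟩
    exact ⟨(A, B), ⟨hA, hB⟩, by simp [parabolicElement, Matrix.fromBlocks_multiply]⟩
  · rintro ⟨⟨A, B⟩, ⟨hA, hB⟩, rfl⟩
    exact ⟨A, B, hA, hB, by simp [parabolicElement, Matrix.fromBlocks_multiply]⟩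

theorem injOn_parabolicElement : Set.InjOn (parabolicElement (F := F) (n := n))
    ({A | IsUnit A.det} ×ˢ (alternatingMatrices F (Fin n) : Set _)) := by
  rintro ⟨A, B⟩ ⟨hA, -⟩ ⟨A', B'⟩ - h
  simp only [parabolicElement, Matrix.fromBlocks_inj] at h
  obtain ⟨rfl, h, -⟩ := h
  have := congrArg (fun t => A⁻¹ * t) h
  simp only [← Matrix.mul_assoc, Matrix.nonsing_inv_mul _ hA, Matrix.one_mul] at this
  rw [this]

/-- Preservation of the form is multiplicative, so membership of a product in the parabolic subgroup
comes down to its lower left block. For a block triangular matrix the form determines the second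
diagonal block and makes the unipotent part alternating. -/
theorem mem_parabolic_iff {w : Matrix (Fin n ⊕ Fin n) (Fin n ⊕ Fin n) F} :
    w ∈ parabolic F n ↔ w.toBlocks₂₁ = 0 ∧ PreservesHyperbolic w := by
  constructor
  · rw [parabolic_eq_image]
    rintro ⟨⟨A, B⟩, ⟨hA, hB⟩, rfl⟩
    refine ⟨by simp [parabolicElement], ?_⟩
    rw [parabolicElement, preservesHyperbolic_fromBlocks_zero₂₁]
    have h1 : Aᵀ * (A⁻¹)ᵀ = 1 := by
      rw [← Matrix.transpose_mul, Matrix.nonsing_inv_mul _ hA, Matrix.transpose_one]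
    refine ⟨h1, ?_⟩
    dsimp only
    rw [Matrix.transpose_mul, Matrix.mul_assoc, h1, Matrix.mul_one]
    exact transpose_mem_alternatingMatrices hB
  · rintro ⟨h1, h2⟩
    rw [← Matrix.fromBlocks_toBlocks w, h1, preservesHyperbolic_fromBlocks_zero₂₁] at h2
    obtain ⟨h3, h4⟩ := h2
    have h5 : w.toBlocks₂₂ᵀ * w.toBlocks₁₁ = 1 := by
      rw [← Matrix.transpose_one, ← h3, Matrix.transpose_mul, Matrix.transpose_transpose]
    have h6 : w.toBlocks₁₁ * w.toBlocks₂₂ᵀ = 1 := mul_eq_one_comm.1 h5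
    rw [parabolic_eq_image]
    refine ⟨(w.toBlocks₁₁, w.toBlocks₂₂ᵀ * w.toBlocks₁₂), ⟨?_, ?_⟩, ?_⟩
    · exact (Matrix.isUnit_iff_isUnit_det _).1 (IsUnit.of_mul_eq_one _ h6)
    · have := transpose_mem_alternatingMatrices h4
      rwa [Matrix.transpose_mul, Matrix.transpose_transpose] at this
    · rw [parabolicElement]
      conv_rhs => rw [← Matrix.fromBlocks_toBlocks w]
      dsimp only
      rw [Matrix.inv_eq_right_inv h6, h1, ← Matrix.mul_assoc, h6, Matrix.one_mul,
        Matrix.transpose_transpose]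

theorem mul_mem_parabolic {x y : Matrix (Fin n ⊕ Fin n) (Fin n ⊕ Fin n) F}
    (hx : x ∈ parabolic F n) (hy : y ∈ parabolic F n) : x * y ∈ parabolic F n := by
  rw [mem_parabolic_iff] at *
  refine ⟨?_, hx.2.mul hy.2⟩
  rw [← Matrix.fromBlocks_toBlocks x, ← Matrix.fromBlocks_toBlocks y, hx.1, hy.1,
    Matrix.fromBlocks_multiply]
  simp

theorem inv_mem_parabolic {x : Matrix (Fin n ⊕ Fin n) (Fin n ⊕ Fin n) F}
    (hx : x ∈ parabolic F n) : x⁻¹ ∈ parabolic F n ∧ x * x⁻¹ = 1 ∧ x⁻¹ * x = 1 := by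
  rw [parabolic_eq_image] at hx
  obtain ⟨⟨A, B⟩, ⟨hA, hB⟩, rfl⟩ := hx
  dsimp only at hA hB
  have hA' : IsUnit A⁻¹.det := by
    rw [Matrix.det_nonsing_inv]; exact hA.ringInverse
  have hm : parabolicElement (A⁻¹, -(A * B * Aᵀ)) ∈ parabolic F n := by
    rw [parabolic_eq_image]
    exact ⟨(A⁻¹, -(A * B * Aᵀ)), ⟨hA', Submodule.neg_mem _ (congr_mem_alternatingMatrices A hB)⟩, rfl⟩
  have h1 : Aᵀ * (A⁻¹)ᵀ = 1 := by
    rw [← Matrix.transpose_mul, Matrix.nonsing_inv_mul _ hA, Matrix.transpose_one]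
  have h2 : (A⁻¹)ᵀ * Aᵀ = 1 := mul_eq_one_comm.1 h1
  have h : parabolicElement (A, B) * parabolicElement (A⁻¹, -(A * B * Aᵀ)) = 1 := by
    simp only [parabolicElement, Matrix.fromBlocks_multiply, Matrix.nonsing_inv_nonsing_inv _ hA,
      Matrix.mul_zero, Matrix.zero_mul, add_zero, zero_add, Matrix.mul_nonsing_inv _ hA, h2]
    rw [Matrix.mul_neg, Matrix.mul_neg, ← Matrix.mul_assoc, Matrix.mul_nonsing_inv _ hA,
      Matrix.one_mul, neg_add_cancel, Matrix.fromBlocks_one]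
  rw [Matrix.inv_eq_right_inv h]
  exact ⟨hm, h, mul_eq_one_comm.1 h⟩

end Parabolic

/-! ### The involutions -/

section Involution

variable (F : Type*) [Field F] (n k : ℕ)

theorem headProj_mul_headProj : headProj F n k * headProj F n k = headProj F n k := by
  simp [headProj]

theorem tailProj_mul_tailProj : tailProj F n k * tailProj F n k = tailProj F n k := by
  simp [tailProj]

theorem headProj_mul_tailProj : headProj F n k * tailProj F n k = 0 := by
  rw [headProj, tailProj, Matrix.diagonal_mul_diagonal, Matrix.diagonal_eq_zero]
  funext i; simp

theorem tailProj_mul_headProj : tailProj F n k * headProj F n k = 0 := by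
  rw [headProj, tailProj, Matrix.diagonal_mul_diagonal, Matrix.diagonal_eq_zero]
  funext i; simp

theorem headProj_add_tailProj : headProj F n k + tailProj F n k = 1 := by
  rw [headProj, tailProj, Matrix.diagonal_add, ← Matrix.diagonal_one]
  congr 1; funext i; split_ifs <;> simp

theorem headProj_transpose : (headProj F n k)ᵀ = headProj F n k :=
  Matrix.diagonal_transpose _

theorem tailProj_transpose : (tailProj F n k)ᵀ = tailProj F n k :=
  Matrix.diagonal_transpose _

theorem sigmaPlus_mul_self : sigmaPlus F n k * sigmaPlus F n k = 1 := by
  rw [sigmaPlus, Matrix.fromBlocks_multiply]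
  simp only [headProj_mul_headProj, tailProj_mul_tailProj, headProj_mul_tailProj,
    tailProj_mul_headProj, zero_add, headProj_add_tailProj]
  rw [add_comm, headProj_add_tailProj, Matrix.fromBlocks_one]

theorem preservesHyperbolic_sigmaPlus : PreservesHyperbolic (sigmaPlus F n k) := by
  -- The Gram matrix is not symmetric, so it is not fixed exactly; the difference is alternating
  -- because the head projection is symmetric.
  have h : (sigmaPlus F n k)ᵀ * hyperbolicGram F n * sigmaPlus F n k - hyperbolicGram F n =
      Matrix.fromBlocks 0 (-headProj F n k) (headProj F n k) 0 := by
    simp only [sigmaPlus, hyperbolicGram, Matrix.fromBlocks_transpose, headProj_transpose,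
      tailProj_transpose, Matrix.fromBlocks_multiply, fromBlocks_sub_fromBlocks, Matrix.mul_zero,
      Matrix.mul_one, zero_add, add_zero, Matrix.zero_mul, headProj_mul_headProj,
      tailProj_mul_tailProj, headProj_mul_tailProj, tailProj_mul_headProj]
    rw [← headProj_add_tailProj F n k]
    simp
  unfold PreservesHyperbolic
  rw [h]
  have h' : ∀ i j, headProj F n k i j = headProj F n k j i := fun i j =>
    congrFun (congrFun (headProj_transpose F n k) j) i
  refine ⟨?_, ?_⟩
  · rintro (i | i) <;> simp
  · rintro (i | i) (j | j)
    · simp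
    · simp [h' i j]
    · simp [h' i j]
    · simp

end Involution

/-! ### Elements of the parabolic subgroup by the trace of their translate -/

section Fibres

theorem ncard_fibrewise {α β : Type*} [Fintype α] [Finite β] (S : Finset α) (Q : α → Set β) :
    {z : α × β | z.1 ∈ S ∧ z.2 ∈ Q z.1}.ncard = ∑ a ∈ S, (Q a).ncard := by
  classical
  have : Fintype β := Fintype.ofFinite β
  have h : {z : α × β | z.1 ∈ S ∧ z.2 ∈ Q z.1} =
      ((S.sigma fun a => (Q a).toFinset).map (Equiv.sigmaEquivProd α β).toEmbedding : Finset _) := by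
    ext ⟨a, b⟩
    simp
  rw [h, Set.ncard_coe_finset, Finset.card_map, Finset.card_sigma]
  exact Finset.sum_congr rfl fun a _ => (Set.ncard_eq_toFinset_card' _).symm

/-- Translating one fibre by the multiples of a vector `v` of `W` with `φ v ≠ 0` covers `W` exactly
once, so a nonzero functional is equidistributed. -/
theorem card_mul_ncard_fibre {F V : Type*} [Field F] [Fintype F] [AddCommGroup V] [Module F V]
    (W : Submodule F V) (φ : V →ₗ[F] F) (h : ∃ v ∈ W, φ v ≠ 0) (x : F) :
    Fintype.card F * {v | v ∈ W ∧ φ v = x}.ncard = (W : Set V).ncard := by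
  obtain ⟨v, hv, hφ⟩ := h
  rw [← Nat.card_eq_fintype_card, ← Set.ncard_univ, ← Set.ncard_prod]
  refine Set.ncard_congr (fun z _ => z.2 + z.1 • v) ?_ ?_ ?_
  · rintro ⟨c, w⟩ ⟨-, hw, -⟩
    exact W.add_mem hw (W.smul_mem c hv)
  · rintro ⟨c, w⟩ ⟨c', w'⟩ ⟨-, hw, h1⟩ ⟨-, hw', h2⟩ h
    dsimp only at h h1 h2
    have h3 := congrArg φ h
    simp only [map_add, map_smul, h1, h2, smul_eq_mul, add_right_inj] at h3
    have h4 := mul_right_cancel₀ hφ h3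
    subst h4
    rw [add_right_cancel h]
  · intro w hw
    refine ⟨((φ w - x) / φ v, w - ((φ w - x) / φ v) • v), ⟨trivial, ?_, ?_⟩, by simp⟩
    · exact W.sub_mem hw (W.smul_mem _ hv)
    · simp [hφ]

end Fibres

theorem trace_fromBlocks_eq {R m n : Type*} [Fintype m] [Fintype n] [AddCommMonoid R]
    (a : Matrix m m R) (b : Matrix m n R) (c : Matrix n m R) (d : Matrix n n R) :
    (Matrix.fromBlocks a b c d).trace = a.trace + d.trace := by
  simp [Matrix.trace, Fintype.sum_sum_type]

section TraceCount

variable {F : Type*} [Field F] {n : ℕ}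

/-- The linear functional `B ↦ tr (X B)` vanishes on alternating matrices only if `X` is
symmetric. -/
theorem trace_mul_alternating_eq_zero_iff {ι : Type*} [Fintype ι] (X : Matrix ι ι F) :
    (∀ B ∈ alternatingMatrices F ι, (X * B).trace = 0) ↔ Xᵀ = X := by
  have key : ∀ C : Matrix ι ι F, (X * (C - Cᵀ)).trace = (X * C).trace - (Xᵀ * C).trace := by
    intro C
    rw [Matrix.mul_sub, Matrix.trace_sub, ← Matrix.trace_transpose (X * Cᵀ),
      Matrix.transpose_mul, Matrix.transpose_transpose, Matrix.trace_mul_comm C]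
  constructor
  · intro h
    refine (Matrix.ext_iff_trace_mul_right.2 fun C => ?_).symm
    rw [← sub_eq_zero, ← key]
    exact h _ (sub_transpose_mem_alternatingMatrices C)
  · intro h B hB
    obtain ⟨C, rfl⟩ := exists_eq_sub_transpose hB
    rw [key, h, sub_self]

/-- The contribution of the lower right corner of the Levi part to the trace. -/
noncomputable def cornerTrace (k : ℕ) (A : Matrix (Fin n) (Fin n) F) : F :=
  (A * tailProj F n k).trace + (A⁻¹ * tailProj F n k).trace

theorem trace_parabolicElement_mul_sigmaPlus (k : ℕ) (A B : Matrix (Fin n) (Fin n) F) :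
    (parabolicElement (A, B) * sigmaPlus F n k).trace =
      cornerTrace k A + (headProj F n k * A * B).trace := by
  rw [parabolicElement, sigmaPlus, Matrix.fromBlocks_multiply, trace_fromBlocks_eq, cornerTrace,
    Matrix.zero_mul, zero_add, Matrix.trace_add, Matrix.mul_assoc (headProj F n k),
    Matrix.trace_mul_comm (headProj F n k), ← Matrix.trace_transpose (_ᵀ * _),
    Matrix.transpose_mul, Matrix.transpose_transpose, tailProj_transpose,
    Matrix.trace_mul_comm (tailProj F n k)]
  ring

/-- The invertible matrices whose first `k` rows, completed by zeros, form a symmetric matrix. -/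
def headSymmetric (F : Type*) [Field F] (n k : ℕ) : Set (Matrix (Fin n) (Fin n) F) :=
  {A | IsUnit A.det ∧ (headProj F n k * A)ᵀ = headProj F n k * A}

/-- For each `A` outside `headSymmetric` the fraction `1/q` of all `B` gives trace `b`; for `A`
inside, either all `B` do or none. The equation is multiplied by `q`, and the subtracted term is
moved to the left, to stay in `ℕ`. -/
theorem card_mul_ncard_trace_parabolic_mul_sigmaPlus [Fintype F] (k : ℕ) (b : F) :
    Fintype.card F * {p | p ∈ parabolic F n ∧ (p * sigmaPlus F n k).trace = b}.ncard +
      (alternatingMatrices F (Fin n) : Set (Matrix (Fin n) (Fin n) F)).ncard * (headSymmetric F n k).ncard =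
    (alternatingMatrices F (Fin n) : Set (Matrix (Fin n) (Fin n) F)).ncard *
      (Fintype.card F * {A | A ∈ headSymmetric F n k ∧ cornerTrace k A = b}.ncard +
        {A : Matrix (Fin n) (Fin n) F | IsUnit A.det}.ncard) := by
  classical
  have h1 : {p | p ∈ parabolic F n ∧ (p * sigmaPlus F n k).trace = b} = parabolicElement ''
      {z : Matrix (Fin n) (Fin n) F × Matrix (Fin n) (Fin n) F |
        z.1 ∈ Finset.univ.filter (fun A : Matrix (Fin n) (Fin n) F => IsUnit A.det) ∧
        z.2 ∈ {B | B ∈ alternatingMatrices F (Fin n) ∧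
          (headProj F n k * z.1 * B).trace = b - cornerTrace k z.1}} := by
    ext p
    constructor
    · rintro ⟨hp, hb⟩
      rw [parabolic_eq_image] at hp
      obtain ⟨⟨A, B⟩, ⟨hA, hB⟩, rfl⟩ := hp
      refine ⟨(A, B), ⟨by simpa using hA, hB, ?_⟩, rfl⟩
      rw [trace_parabolicElement_mul_sigmaPlus] at hb
      rw [← hb, add_sub_cancel_left]
    · rintro ⟨⟨A, B⟩, ⟨hA, hB, hb⟩, rfl⟩
      refine ⟨?_, ?_⟩
      · rw [parabolic_eq_image]
        exact ⟨(A, B), ⟨by simpa using hA, hB⟩, rfl⟩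
      · rw [trace_parabolicElement_mul_sigmaPlus]
        dsimp only at hb
        rw [hb, add_sub_cancel]
  have h2 : ∀ p : Matrix (Fin n) (Fin n) F → Prop, {A | IsUnit A.det ∧ p A}.ncard =
      ∑ A : Matrix (Fin n) (Fin n) F with IsUnit A.det, if p A then 1 else 0 := by
    intro p
    rw [← Finset.card_filter, Finset.filter_filter, ← Set.ncard_coe_finset]
    congr 1
    ext; simp
  have h3 : {A : Matrix (Fin n) (Fin n) F | IsUnit A.det}.ncard =
      ∑ A : Matrix (Fin n) (Fin n) F with IsUnit A.det, 1 := by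
    rw [← Finset.card_eq_sum_ones, ← Set.ncard_coe_finset]
    congr 1
    ext; simp
  have h4 : {A | A ∈ headSymmetric F n k ∧ cornerTrace k A = b} =
      {A | IsUnit A.det ∧ ((headProj F n k * A)ᵀ = headProj F n k * A ∧ cornerTrace k A = b)} := by
    ext A; simp [headSymmetric, and_assoc]
  have h5 := ncard_fibrewise
    (Finset.univ.filter (fun A : Matrix (Fin n) (Fin n) F => IsUnit A.det))
    (fun A : Matrix (Fin n) (Fin n) F => {B : Matrix (Fin n) (Fin n) F |
      B ∈ alternatingMatrices F (Fin n) ∧ (headProj F n k * A * B).trace = b - cornerTrace k A})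
  rw [h1, Set.InjOn.ncard_image, h5, h4, headSymmetric, h2, h2, h3, Finset.mul_sum,
    Finset.mul_sum, Finset.mul_sum, ← Finset.sum_add_distrib, ← Finset.sum_add_distrib,
    Finset.mul_sum]
  · refine Finset.sum_congr rfl fun A _ => ?_
    by_cases hs : (headProj F n k * A)ᵀ = headProj F n k * A
    · have h5 := (trace_mul_alternating_eq_zero_iff _).2 hs
      by_cases hb : cornerTrace k A = b
      · have : {B | B ∈ alternatingMatrices F (Fin n) ∧
          (headProj F n k * A * B).trace = b - cornerTrace k A} =
            (alternatingMatrices F (Fin n) : Set _) := by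
          ext B
          exact ⟨fun h => h.1, fun h => ⟨h, by rw [h5 B h, hb, sub_self]⟩⟩
        rw [this, if_pos hs, if_pos ⟨hs, hb⟩]
        ring
      · have : {B | B ∈ alternatingMatrices F (Fin n) ∧
          (headProj F n k * A * B).trace = b - cornerTrace k A} = ∅ := by
          ext B
          refine ⟨fun h => hb ?_, fun h => h.elim⟩
          have := h.2
          rw [h5 B h.1] at this
          exact (sub_eq_zero.1 this.symm).symm
        rw [this, if_pos hs, if_neg (fun h => hb h.2), Set.ncard_empty]
        ring
    · have h5 := (trace_mul_alternating_eq_zero_iff _).not.2 hs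
      push Not at h5
      have h6 := card_mul_ncard_fibre (alternatingMatrices F (Fin n))
        ((Matrix.traceLinearMap (Fin n) F F).comp
          (LinearMap.mulLeft F (headProj F n k * A))) h5 (b - cornerTrace k A)
      simp only [LinearMap.comp_apply, LinearMap.mulLeft_apply, Matrix.traceLinearMap_apply] at h6
      rw [h6, if_neg hs, if_neg (fun h => hs h.1)]
      ring
  · refine injOn_parabolicElement.mono ?_
    rintro ⟨A, B⟩ ⟨hA, hB, -⟩
    exact ⟨by simpa using hA, hB⟩

theorem ncard_parabolic :
    (parabolic F n).ncard = {A : Matrix (Fin n) (Fin n) F | IsUnit A.det}.ncard *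
      (alternatingMatrices F (Fin n) : Set (Matrix (Fin n) (Fin n) F)).ncard := by
  rw [parabolic_eq_image, injOn_parabolicElement.ncard_image, Set.ncard_prod]

/-- A block triangularity condition for a matrix is inherited by its inverse. -/
theorem headProj_mul_inv_mul_tailProj [Finite F] (k : ℕ) {A : Matrix (Fin n) (Fin n) F}
    (hA : IsUnit A.det) (h : headProj F n k * A * tailProj F n k = 0) :
    headProj F n k * A⁻¹ * tailProj F n k = 0 := by
  -- Over a finite field `A` has finite order, so its inverse is one of its powers, and powers
  -- inherit the triangular shape.
  have hpow : ∀ j : ℕ, headProj F n k * A ^ j * tailProj F n k = 0 := by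
    intro j
    induction j with
    | zero => rw [pow_zero, Matrix.mul_one, headProj_mul_tailProj]
    | succ j ih =>
      have h1 : headProj F n k * A ^ j =
          headProj F n k * A ^ j * headProj F n k := by
        conv_lhs => rw [← Matrix.mul_one (headProj F n k * A ^ j),
          ← headProj_add_tailProj F n k, Matrix.mul_add, ih, add_zero]
      rw [pow_succ, ← Matrix.mul_assoc, h1, Matrix.mul_assoc _ (headProj F n k), Matrix.mul_assoc,
        h, Matrix.mul_zero]
  obtain ⟨u, rfl⟩ := (Matrix.isUnit_iff_isUnit_det A).2 hA
  obtain ⟨j, hj, hu⟩ := (isOfFinOrder_of_finite u).exists_pow_eq_one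
  have : (u : Matrix (Fin n) (Fin n) F)⁻¹ = (u : Matrix (Fin n) (Fin n) F) ^ (j - 1) := by
    refine Matrix.inv_eq_right_inv ?_
    rw [← pow_succ', Nat.sub_add_cancel hj, ← Units.val_pow_eq_pow_val, hu, Units.val_one]
  rw [this, hpow]

/-- The stabiliser of a coset, in terms of Levi and unipotent parts. -/
theorem ncard_parabolic_inter_conj [Finite F] (k : ℕ) :
    {p | p ∈ parabolic F n ∧ sigmaPlus F n k * p * sigmaPlus F n k ∈ parabolic F n}.ncard =
      {A | IsUnit A.det ∧ headProj F n k * A * tailProj F n k = 0}.ncard *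
      {B | B ∈ alternatingMatrices F (Fin n) ∧
        headProj F n k * B * headProj F n k = 0}.ncard := by
  rw [← Set.ncard_prod, ← Set.InjOn.ncard_image (f := parabolicElement)]
  · congr 1
    have key : ∀ A B : Matrix (Fin n) (Fin n) F, IsUnit A.det →
        B ∈ alternatingMatrices F (Fin n) →
        (sigmaPlus F n k * parabolicElement (A, B) * sigmaPlus F n k ∈ parabolic F n ↔
          headProj F n k * A * tailProj F n k = 0 ∧
            headProj F n k * B * headProj F n k = 0) := by
      intro A B hA hB
      have hp : parabolicElement (A, B) ∈ parabolic F n := by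
        rw [parabolic_eq_image]; exact ⟨(A, B), ⟨hA, hB⟩, rfl⟩
      -- The conjugate preserves the form automatically; only its lower left block imposes
      -- conditions.
      have hO : PreservesHyperbolic
          (sigmaPlus F n k * parabolicElement (A, B) * sigmaPlus F n k) :=
        ((preservesHyperbolic_sigmaPlus F n k).mul (mem_parabolic_iff.1 hp).2).mul
          (preservesHyperbolic_sigmaPlus F n k)
      have hc : (sigmaPlus F n k * parabolicElement (A, B) * sigmaPlus F n k).toBlocks₂₁ =
          headProj F n k * A * tailProj F n k + headProj F n k * (A * B) * headProj F n k +
            tailProj F n k * (A⁻¹)ᵀ * headProj F n k := by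
        simp [sigmaPlus, parabolicElement, Matrix.fromBlocks_multiply, Matrix.add_mul, add_assoc]
      rw [mem_parabolic_iff, and_iff_left hO, hc]
      set H := headProj F n k
      set T := tailProj F n k
      have hHH : H * H = H := headProj_mul_headProj F n k
      have hTT : T * T = T := tailProj_mul_tailProj F n k
      have hHT : H * T = 0 := headProj_mul_tailProj F n k
      have hTH : T * H = 0 := tailProj_mul_headProj F n k
      have h1 : H + T = 1 := headProj_add_tailProj F n k
      have hHA : H * A * T = 0 → H * A = H * A * H := by
        intro h
        conv_lhs => rw [← Matrix.mul_one (H * A), ← h1, Matrix.mul_add, h, add_zero]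
      constructor
      · intro h
        -- The three summands of the block lie in the `HT`, `HH` and `TH` corners, so multiplying by
        -- projections on both sides separates them.
        have e1 : H * A * T = 0 := by
          have := congrArg (fun X => H * X * T) h
          simpa only [Matrix.mul_add, Matrix.add_mul, ← Matrix.mul_assoc, hHH, hHT, hTT, hTH,
            Matrix.zero_mul, add_zero, Matrix.mul_assoc _ H T, Matrix.mul_zero,
            Matrix.mul_assoc _ T T] using this
        have e2 : T * (A⁻¹)ᵀ * H = 0 := by
          have := congrArg (fun X => T * X * H) h
          simpa only [Matrix.mul_add, Matrix.add_mul, ← Matrix.mul_assoc, hHH, hHT, hTT, hTH,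
            Matrix.zero_mul, zero_add, Matrix.mul_assoc _ H H, Matrix.mul_zero,
            Matrix.mul_assoc _ T T] using this
        have e3 : H * A⁻¹ * T = 0 := by
          have := congrArg Matrix.transpose e2
          rwa [Matrix.transpose_mul, Matrix.transpose_mul, Matrix.transpose_transpose,
            headProj_transpose, tailProj_transpose, Matrix.transpose_zero,
            ← Matrix.mul_assoc] at this
        rw [e1, e2, zero_add, add_zero, ← Matrix.mul_assoc, hHA e1] at h
        refine ⟨e1, ?_⟩
        -- Since `H A⁻¹ T = 0`, the factor `H A` can be cancelled from `H A H B H = 0`.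
        calc H * B * H = H * (A⁻¹ * A) * (H * B * H) := by
              rw [Matrix.nonsing_inv_mul _ hA, Matrix.mul_one, ← Matrix.mul_assoc,
                ← Matrix.mul_assoc, hHH]
          _ = H * A⁻¹ * (H + T) * (A * (H * B * H)) := by
              rw [h1, Matrix.mul_one]; simp only [Matrix.mul_assoc]
          _ = H * A⁻¹ * (H * A * H * B * H) + H * A⁻¹ * T * (A * (H * B * H)) := by
              simp only [Matrix.mul_add, Matrix.add_mul, Matrix.mul_assoc]
          _ = 0 := by rw [h, e3, Matrix.mul_zero, Matrix.zero_mul, add_zero]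
      · rintro ⟨e1, e2⟩
        have e3 : T * (A⁻¹)ᵀ * H = 0 := by
          have := congrArg Matrix.transpose (headProj_mul_inv_mul_tailProj k hA e1)
          rwa [Matrix.transpose_mul, Matrix.transpose_mul,
            headProj_transpose, tailProj_transpose, Matrix.transpose_zero,
            ← Matrix.mul_assoc] at this
        rw [e1, e3, zero_add, add_zero, ← Matrix.mul_assoc, hHA e1, Matrix.mul_assoc,
          Matrix.mul_assoc, ← Matrix.mul_assoc H B, e2, Matrix.mul_zero]
    ext p
    constructor
    · rintro ⟨hp, hs⟩
      rw [parabolic_eq_image] at hp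
      obtain ⟨⟨A, B⟩, ⟨hA, hB⟩, rfl⟩ := hp
      obtain ⟨h1, h2⟩ := (key A B hA hB).1 hs
      exact ⟨(A, B), ⟨⟨hA, h1⟩, ⟨hB, h2⟩⟩, rfl⟩
    · rintro ⟨⟨A, B⟩, ⟨⟨hA, h1⟩, ⟨hB, h2⟩⟩, rfl⟩
      refine ⟨?_, (key A B hA hB).2 ⟨h1, h2⟩⟩
      rw [parabolic_eq_image]; exact ⟨(A, B), ⟨hA, hB⟩, rfl⟩
  · refine injOn_parabolicElement.mono ?_
    rintro ⟨A, B⟩ ⟨⟨hA, -⟩, ⟨hB, -⟩⟩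
    exact ⟨hA, hB⟩

end TraceCount

/-! ### Block decompositions -/

section Blocks

variable {F : Type*} {r m : ℕ}

/-- Transport of a block matrix to the index type `Fin (r + m)`. -/
def ofBlocks (a : Matrix (Fin r) (Fin r) F) (b : Matrix (Fin r) (Fin m) F)
    (c : Matrix (Fin m) (Fin r) F) (d : Matrix (Fin m) (Fin m) F) :
    Matrix (Fin (r + m)) (Fin (r + m)) F :=
  (Matrix.fromBlocks a b c d).submatrix finSumFinEquiv.symm finSumFinEquiv.symm

theorem exists_eq_ofBlocks (A : Matrix (Fin (r + m)) (Fin (r + m)) F) :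
    ∃ a b c d, A = ofBlocks a b c d := by
  let A' := A.submatrix finSumFinEquiv finSumFinEquiv
  refine ⟨A'.toBlocks₁₁, A'.toBlocks₁₂, A'.toBlocks₂₁, A'.toBlocks₂₂, ?_⟩
  rw [ofBlocks, Matrix.fromBlocks_toBlocks]
  ext i j
  simp [A']

theorem ofBlocks_inj {a a' : Matrix (Fin r) (Fin r) F} {b b' : Matrix (Fin r) (Fin m) F}
    {c c' : Matrix (Fin m) (Fin r) F} {d d' : Matrix (Fin m) (Fin m) F} :
    ofBlocks a b c d = ofBlocks a' b' c' d' ↔ a = a' ∧ b = b' ∧ c = c' ∧ d = d' := by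
  rw [← Matrix.fromBlocks_inj]
  constructor
  · intro h
    ext i j
    have := congrFun (congrFun h (finSumFinEquiv i)) (finSumFinEquiv j)
    simpa [ofBlocks] using this
  · intro h
    rw [ofBlocks, h, ← ofBlocks]

theorem ofBlocks_transpose (a : Matrix (Fin r) (Fin r) F) (b : Matrix (Fin r) (Fin m) F)
    (c : Matrix (Fin m) (Fin r) F) (d : Matrix (Fin m) (Fin m) F) :
    (ofBlocks a b c d)ᵀ = ofBlocks aᵀ cᵀ bᵀ dᵀ := by
  rw [ofBlocks, Matrix.transpose_submatrix, Matrix.fromBlocks_transpose, ofBlocks]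

variable [Field F]

theorem ofBlocks_mul (a a' : Matrix (Fin r) (Fin r) F) (b b' : Matrix (Fin r) (Fin m) F)
    (c c' : Matrix (Fin m) (Fin r) F) (d d' : Matrix (Fin m) (Fin m) F) :
    ofBlocks a b c d * ofBlocks a' b' c' d' =
      ofBlocks (a * a' + b * c') (a * b' + b * d') (c * a' + d * c') (c * b' + d * d') := by
  rw [ofBlocks, ofBlocks, Matrix.submatrix_mul_equiv, Matrix.fromBlocks_multiply, ofBlocks]

theorem ofBlocks_zero : ofBlocks (0 : Matrix (Fin r) (Fin r) F) (0 : Matrix (Fin r) (Fin m) F)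
    0 0 = 0 := by
  rw [ofBlocks, Matrix.fromBlocks_zero, Matrix.submatrix_zero]; rfl

theorem trace_ofBlocks (a : Matrix (Fin r) (Fin r) F) (b : Matrix (Fin r) (Fin m) F)
    (c : Matrix (Fin m) (Fin r) F) (d : Matrix (Fin m) (Fin m) F) :
    (ofBlocks a b c d).trace = a.trace + d.trace := by
  rw [← trace_fromBlocks_eq a b c d, ofBlocks, Matrix.trace, Matrix.trace]
  exact Equiv.sum_comp finSumFinEquiv.symm (fun i => (Matrix.fromBlocks a b c d).diag i)

theorem det_ofBlocks_zero (a : Matrix (Fin r) (Fin r) F)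
    (c : Matrix (Fin m) (Fin r) F) (d : Matrix (Fin m) (Fin m) F) :
    (ofBlocks a 0 c d).det = a.det * d.det := by
  rw [ofBlocks, Matrix.det_submatrix_equiv_self, Matrix.det_fromBlocks_zero₁₂]

theorem inv_ofBlocks_zero (a : Matrix (Fin r) (Fin r) F)
    (c : Matrix (Fin m) (Fin r) F) (d : Matrix (Fin m) (Fin m) F) (ha : IsUnit a.det)
    (hd : IsUnit d.det) :
    (ofBlocks a 0 c d)⁻¹ = ofBlocks a⁻¹ 0 (-(d⁻¹ * c * a⁻¹)) d⁻¹ := by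
  rw [ofBlocks, Matrix.inv_submatrix_equiv, Matrix.inv_fromBlocks_zero₁₂_of_isUnit_iff, ofBlocks]
  rw [Matrix.isUnit_iff_isUnit_det, Matrix.isUnit_iff_isUnit_det]
  exact iff_of_true ha hd

theorem headProj_eq_ofBlocks : headProj F (r + m) r = ofBlocks 1 0 0 0 := by
  rw [ofBlocks, ← Matrix.diagonal_one, ← Matrix.diagonal_zero, Matrix.fromBlocks_diagonal,
    Matrix.submatrix_diagonal_equiv, headProj]
  congr 1
  funext i
  refine Fin.addCases (fun i => ?_) (fun i => ?_) i <;> simp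

theorem tailProj_eq_ofBlocks : tailProj F (r + m) r = ofBlocks 0 0 0 1 := by
  rw [ofBlocks, ← Matrix.diagonal_one, ← Matrix.diagonal_zero, Matrix.fromBlocks_diagonal,
    Matrix.submatrix_diagonal_equiv, tailProj]
  congr 1
  funext i
  refine Fin.addCases (fun i => ?_) (fun i => ?_) i <;> simp

theorem ncard_headProj_mul_tailProj_eq_zero [Fintype F] :
    {A | IsUnit A.det ∧ headProj F (r + m) r * A * tailProj F (r + m) r = 0}.ncard =
      {A : Matrix (Fin r) (Fin r) F | IsUnit A.det}.ncard * Fintype.card F ^ (r * m) *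
        {A : Matrix (Fin m) (Fin m) F | IsUnit A.det}.ncard := by
  have hc : Fintype.card F ^ (r * m) = (Set.univ : Set (Matrix (Fin m) (Fin r) F)).ncard := by
    rw [Set.ncard_univ]
    simp [Nat.card_eq_fintype_card, Matrix, ← pow_mul]
  rw [hc, ← Set.ncard_prod, ← Set.ncard_prod, ← Set.ncard_image_of_injective
    (f := fun z : (Matrix (Fin r) (Fin r) F × Matrix (Fin m) (Fin r) F) ×
      Matrix (Fin m) (Fin m) F => ofBlocks z.1.1 0 z.1.2 z.2)]
  · congr 1
    ext A
    constructor
    · rintro ⟨hA, h⟩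
      obtain ⟨a, b, c, d, rfl⟩ := exists_eq_ofBlocks A
      simp only [headProj_eq_ofBlocks, tailProj_eq_ofBlocks, ofBlocks_mul, ← ofBlocks_zero,
        ofBlocks_inj, Matrix.one_mul, Matrix.mul_one, Matrix.zero_mul, Matrix.mul_zero, add_zero,
        zero_add] at h
      obtain ⟨-, rfl, -, -⟩ := h
      rw [det_ofBlocks_zero, IsUnit.mul_iff] at hA
      exact ⟨((a, c), d), ⟨⟨hA.1, trivial⟩, hA.2⟩, rfl⟩
    · rintro ⟨⟨⟨a, c⟩, d⟩, ⟨⟨ha, -⟩, hd⟩, rfl⟩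
      refine ⟨?_, ?_⟩
      · dsimp only
        rw [det_ofBlocks_zero, IsUnit.mul_iff]
        exact ⟨ha, hd⟩
      · simp [headProj_eq_ofBlocks, tailProj_eq_ofBlocks, ofBlocks_mul, ofBlocks_zero]
  · rintro ⟨⟨a, c⟩, d⟩ ⟨⟨a', c'⟩, d'⟩ h
    obtain ⟨rfl, -, rfl, rfl⟩ := ofBlocks_inj.1 h
    rfl

/-- The number of invertible symmetric matrices. -/
noncomputable def symmetricCount (F ι : Type*) [Field F] [Fintype ι] [DecidableEq ι] : ℕ :=
  {S : Matrix ι ι F | IsUnit S.det ∧ Sᵀ = S}.ncard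

/-- Symmetry of the padded first `r` rows kills the upper right block of `A` and makes the upper
left one symmetric; the lower left block stays free, and the lower right block of `A⁻¹` is `d⁻¹`.
The predicate `p` is left general in order to count both one fibre and the whole set. -/
theorem ncard_headSymmetric_cornerTrace [Fintype F] (p : F → Prop) :
    {A | A ∈ headSymmetric F (r + m) r ∧ p (cornerTrace r A)}.ncard =
      symmetricCount F (Fin r) * Fintype.card F ^ (r * m) *
        {A : Matrix (Fin m) (Fin m) F | IsUnit A.det ∧ p (A.trace + A⁻¹.trace)}.ncard := by
  have hc : Fintype.card F ^ (r * m) = (Set.univ : Set (Matrix (Fin m) (Fin r) F)).ncard := by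
    rw [Set.ncard_univ]
    simp [Nat.card_eq_fintype_card, Matrix, ← pow_mul]
  have hct : ∀ (a : Matrix (Fin r) (Fin r) F) (c : Matrix (Fin m) (Fin r) F)
      (d : Matrix (Fin m) (Fin m) F), IsUnit a.det → IsUnit d.det →
      cornerTrace r (ofBlocks a 0 c d) = d.trace + d⁻¹.trace := by
    intro a c d ha hd
    rw [cornerTrace, inv_ofBlocks_zero _ _ _ ha hd, tailProj_eq_ofBlocks, ofBlocks_mul,
      ofBlocks_mul, trace_ofBlocks, trace_ofBlocks]
    simp
  rw [symmetricCount, hc, ← Set.ncard_prod, ← Set.ncard_prod, ← Set.ncard_image_of_injective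
    (f := fun z : (Matrix (Fin r) (Fin r) F × Matrix (Fin m) (Fin r) F) ×
      Matrix (Fin m) (Fin m) F => ofBlocks z.1.1 0 z.1.2 z.2)]
  · congr 1
    ext A
    constructor
    · rintro ⟨⟨hA, h⟩, hp⟩
      obtain ⟨a, b, c, d, rfl⟩ := exists_eq_ofBlocks A
      simp only [headProj_eq_ofBlocks, ofBlocks_mul, ofBlocks_transpose,
        ofBlocks_inj, Matrix.one_mul, Matrix.zero_mul, add_zero, Matrix.transpose_zero] at h
      obtain ⟨hs, rfl, -, -⟩ := h
      rw [det_ofBlocks_zero, IsUnit.mul_iff] at hA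
      rw [hct _ _ _ hA.1 hA.2] at hp
      exact ⟨((a, c), d), ⟨⟨⟨hA.1, hs⟩, trivial⟩, hA.2, hp⟩, rfl⟩
    · rintro ⟨⟨⟨a, c⟩, d⟩, ⟨⟨⟨ha, hs⟩, -⟩, hd, hp⟩, rfl⟩
      dsimp only at ha hs hd hp ⊢
      refine ⟨⟨?_, ?_⟩, ?_⟩
      · rw [det_ofBlocks_zero, IsUnit.mul_iff]
        exact ⟨ha, hd⟩
      · simp [headProj_eq_ofBlocks, ofBlocks_mul, ofBlocks_transpose, hs]
      · rwa [hct _ _ _ ha hd]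
  · rintro ⟨⟨a, c⟩, d⟩ ⟨⟨a', c'⟩, d'⟩ h
    obtain ⟨rfl, -, rfl, rfl⟩ := ofBlocks_inj.1 h
    rfl

theorem ofBlocks_mem_alternatingMatrices {a : Matrix (Fin r) (Fin r) F}
    {b : Matrix (Fin r) (Fin m) F} {c : Matrix (Fin m) (Fin r) F} {d : Matrix (Fin m) (Fin m) F} :
    ofBlocks a b c d ∈ alternatingMatrices F (Fin (r + m)) ↔
      a ∈ alternatingMatrices F (Fin r) ∧ c = -bᵀ ∧ d ∈ alternatingMatrices F (Fin m) := by
  have h : ofBlocks a b c d ∈ alternatingMatrices F (Fin (r + m)) ↔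
      Matrix.fromBlocks a b c d ∈ alternatingMatrices F (Fin r ⊕ Fin m) := by
    rw [mem_alternatingMatrices, mem_alternatingMatrices]
    simp only [ofBlocks, Matrix.submatrix_apply, finSumFinEquiv.symm.forall_congr_left,
      Equiv.symm_symm, Equiv.symm_apply_apply]
  rw [h, mem_alternatingMatrices, mem_alternatingMatrices, mem_alternatingMatrices]
  simp only [Sum.forall, Matrix.fromBlocks_apply₁₁, Matrix.fromBlocks_apply₁₂,
    Matrix.fromBlocks_apply₂₁, Matrix.fromBlocks_apply₂₂]
  constructor
  · rintro ⟨⟨h1, h2⟩, h3, h4⟩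
    exact ⟨⟨h1, fun i => (h3 i).1⟩, by ext i j; simpa using (h4 i).1 j, h2, fun i => (h4 i).2⟩
  · rintro ⟨⟨h1, h3⟩, rfl, h2, h4⟩
    exact ⟨⟨h1, h2⟩, fun i => ⟨h3 i, fun j => by simp⟩, fun i => ⟨fun j => by simp, h4 i⟩⟩

theorem ncard_alternatingMatrices_add [Fintype F] :
    (alternatingMatrices F (Fin (r + m)) : Set (Matrix (Fin (r + m)) (Fin (r + m)) F)).ncard =
      (alternatingMatrices F (Fin r) : Set (Matrix (Fin r) (Fin r) F)).ncard *
        {B | B ∈ alternatingMatrices F (Fin (r + m)) ∧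
          headProj F (r + m) r * B * headProj F (r + m) r = 0}.ncard ∧
    {B | B ∈ alternatingMatrices F (Fin (r + m)) ∧
          headProj F (r + m) r * B * headProj F (r + m) r = 0}.ncard =
      Fintype.card F ^ (r * m) *
        (alternatingMatrices F (Fin m) : Set (Matrix (Fin m) (Fin m) F)).ncard := by
  have hc : Fintype.card F ^ (r * m) = (Set.univ : Set (Matrix (Fin r) (Fin m) F)).ncard := by
    rw [Set.ncard_univ]
    simp [Nat.card_eq_fintype_card, Matrix, ← pow_mul, mul_comm]
  have h2 : {B | B ∈ alternatingMatrices F (Fin (r + m)) ∧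
          headProj F (r + m) r * B * headProj F (r + m) r = 0}.ncard =
      Fintype.card F ^ (r * m) *
        (alternatingMatrices F (Fin m) : Set (Matrix (Fin m) (Fin m) F)).ncard := by
    rw [hc, ← Set.ncard_prod, ← Set.ncard_image_of_injective
      (f := fun z : Matrix (Fin r) (Fin m) F × Matrix (Fin m) (Fin m) F =>
        ofBlocks 0 z.1 (-z.1ᵀ) z.2)]
    · congr 1
      ext B
      constructor
      · rintro ⟨hB, h⟩
        obtain ⟨a, b, c, d, rfl⟩ := exists_eq_ofBlocks B
        simp only [headProj_eq_ofBlocks, ofBlocks_mul, ← ofBlocks_zero,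
          ofBlocks_inj, Matrix.one_mul, Matrix.mul_one, Matrix.zero_mul, Matrix.mul_zero, add_zero] at h
        obtain ⟨rfl, -, -, -⟩ := h
        obtain ⟨-, rfl, hd⟩ := ofBlocks_mem_alternatingMatrices.1 hB
        exact ⟨(b, d), ⟨trivial, hd⟩, rfl⟩
      · rintro ⟨⟨b, d⟩, ⟨-, hd⟩, rfl⟩
        refine ⟨ofBlocks_mem_alternatingMatrices.2 ⟨Submodule.zero_mem _, rfl, hd⟩, ?_⟩
        simp [headProj_eq_ofBlocks, ofBlocks_mul, ofBlocks_zero]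
    · rintro ⟨b, d⟩ ⟨b', d'⟩ h
      obtain ⟨-, rfl, -, rfl⟩ := ofBlocks_inj.1 h
      rfl
  refine ⟨?_, h2⟩
  rw [h2, hc, ← Set.ncard_prod, ← Set.ncard_prod, ← Set.ncard_image_of_injective
      (f := fun z : Matrix (Fin r) (Fin r) F × Matrix (Fin r) (Fin m) F ×
        Matrix (Fin m) (Fin m) F => ofBlocks z.1 z.2.1 (-z.2.1ᵀ) z.2.2)]
  · congr 1
    ext B
    constructor
    · intro hB
      obtain ⟨a, b, c, d, rfl⟩ := exists_eq_ofBlocks B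
      obtain ⟨ha, rfl, hd⟩ := ofBlocks_mem_alternatingMatrices.1 hB
      exact ⟨(a, b, d), ⟨ha, trivial, hd⟩, rfl⟩
    · rintro ⟨⟨a, b, d⟩, ⟨ha, -, hd⟩, rfl⟩
      exact ofBlocks_mem_alternatingMatrices.2 ⟨ha, rfl, hd⟩
  · rintro ⟨a, b, d⟩ ⟨a', b', d'⟩ h
    obtain ⟨rfl, rfl, -, rfl⟩ := ofBlocks_inj.1 h
    rfl

theorem ncard_alternatingMatrices [Fintype F] (n : ℕ) :
    (alternatingMatrices F (Fin n) : Set (Matrix (Fin n) (Fin n) F)).ncard =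
      Fintype.card F ^ (n.choose 2) := by
  induction n with
  | zero =>
    rw [Nat.choose_zero_succ, pow_zero, Set.ncard_eq_one]
    exact ⟨0, Set.eq_singleton_iff_unique_mem.2
      ⟨Submodule.zero_mem _, fun _ _ => Subsingleton.elim _ _⟩⟩
  | succ n ih =>
    have h1 : (alternatingMatrices F (Fin 1) : Set (Matrix (Fin 1) (Fin 1) F)).ncard = 1 := by
      rw [Set.ncard_eq_one]
      refine ⟨0, Set.eq_singleton_iff_unique_mem.2 ⟨Submodule.zero_mem _, fun B hB => ?_⟩⟩
      ext i j
      rw [Subsingleton.elim j i]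
      exact hB.1 i
    rw [(ncard_alternatingMatrices_add (r := n) (m := 1)).1, ncard_alternatingMatrices_add.2, ih,
      h1, Nat.choose_succ_succ' n 1, Nat.choose_one_right, mul_one, mul_one, pow_add, mul_comm]

end Blocks

/-! ### Counting invertible symmetric matrices -/

section SymmetricCount

variable {F ι : Type*}

/-- The symmetric matrix `[s ᵗv; v S]`. -/
def borderedMatrix (s : F) (v : ι → F) (S : Matrix ι ι F) : Matrix (Unit ⊕ ι) (Unit ⊕ ι) F :=
  Matrix.fromBlocks (Matrix.of fun _ _ => s) (Matrix.replicateRow Unit v)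
    (Matrix.replicateCol Unit v) S

theorem borderedMatrix_inj {s s' : F} {v v' : ι → F} {S S' : Matrix ι ι F} :
    borderedMatrix s v S = borderedMatrix s' v' S' ↔ s = s' ∧ v = v' ∧ S = S' := by
  constructor
  · intro h
    obtain ⟨h1, h2, -, h3⟩ := Matrix.fromBlocks_inj.1 h
    exact ⟨congrFun (congrFun h1 ()) (), Matrix.replicateRow_injective h2, h3⟩
  · rintro ⟨rfl, rfl, rfl⟩
    rfl

theorem transpose_borderedMatrix (s : F) (v : ι → F) (S : Matrix ι ι F) :
    (borderedMatrix s v S)ᵀ = borderedMatrix s v Sᵀ := by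
  rw [borderedMatrix, Matrix.fromBlocks_transpose]
  rfl

theorem exists_eq_borderedMatrix {S : Matrix (Unit ⊕ ι) (Unit ⊕ ι) F} (hS : Sᵀ = S) :
    ∃ s v S', S'ᵀ = S' ∧ S = borderedMatrix s v S' := by
  have h : ∀ i j, S i j = S j i := fun i j => (congrFun (congrFun hS j) i)
  refine ⟨S (Sum.inl ()) (Sum.inl ()), fun j => S (Sum.inl ()) (Sum.inr j), S.toBlocks₂₂, ?_, ?_⟩
  · ext i j
    exact h _ _
  · ext (i | i) (j | j)
    · rfl
    · rfl
    · exact h _ _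
    · rfl

variable [Field F]

theorem symmetricCount_congr {κ : Type*} [Fintype ι] [DecidableEq ι] [Fintype κ] [DecidableEq κ]
    (e : ι ≃ κ) : symmetricCount F ι = symmetricCount F κ := by
  rw [symmetricCount, symmetricCount]
  refine Set.ncard_congr (fun S _ => S.submatrix e.symm e.symm) ?_ ?_ ?_
  · rintro S ⟨h1, h2⟩
    exact ⟨by rwa [Matrix.det_submatrix_equiv_self], by rw [Matrix.transpose_submatrix, h2]⟩
  · intro S S' _ _ h
    ext i j
    simpa using congrFun (congrFun h (e i)) (e j)
  · rintro S ⟨h1, h2⟩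
    exact ⟨S.submatrix e e, ⟨by rwa [Matrix.det_submatrix_equiv_self],
      by rw [Matrix.transpose_submatrix, h2]⟩, by ext; simp⟩

theorem symmetricCount_of_isEmpty [Fintype ι] [DecidableEq ι] [IsEmpty ι] :
    symmetricCount F ι = 1 := by
  rw [symmetricCount, Set.ncard_eq_one]
  exact ⟨1, Set.eq_singleton_iff_unique_mem.2
    ⟨⟨by simp, Matrix.transpose_one⟩, fun _ _ => Subsingleton.elim _ _⟩⟩

variable [Fintype ι] [DecidableEq ι]

/-- Schur complement with respect to the corner `s`. -/
theorem det_borderedMatrix {s : F} (hs : s ≠ 0) (v : ι → F) (S : Matrix ι ι F) :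
    (borderedMatrix s v S).det = s * (S - s⁻¹ • Matrix.vecMulVec v v).det := by
  have h1 : (Matrix.of fun _ _ => s : Matrix Unit Unit F) * (Matrix.of fun _ _ => s⁻¹) = 1 := by
    ext; simp [Matrix.mul_apply, hs]
  let _ : Invertible (Matrix.of fun _ _ => s : Matrix Unit Unit F) :=
    ⟨_, mul_eq_one_comm.1 h1, h1⟩
  rw [borderedMatrix, Matrix.det_fromBlocks₁₁]
  congr 1
  · simp
  · congr 2
    ext i j
    have h2 : ⅟(Matrix.of fun _ _ => s : Matrix Unit Unit F) = Matrix.of fun _ _ => s⁻¹ := rfl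
    rw [h2]
    simp [Matrix.mul_apply, Matrix.vecMulVec_apply]
    ring

variable [Fintype F]

theorem ncard_borderedMatrix_corner_ne_zero :
    {z : F × (ι → F) × Matrix ι ι F | (z.2.2ᵀ = z.2.2 ∧
      IsUnit (borderedMatrix z.1 z.2.1 z.2.2).det) ∧ z.1 ≠ 0}.ncard =
      (Fintype.card F - 1) * (Fintype.card F ^ Fintype.card ι * symmetricCount F ι) := by
  classical
  have h1 : Fintype.card F - 1 = {s : F | s ≠ 0}.ncard := by
    rw [← Fintype.card_units, ← Nat.card_eq_fintype_card, ← Nat.card_coe_set_eq]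
    exact Nat.card_congr unitsEquivNeZero
  have h2 : Fintype.card F ^ Fintype.card ι = (Set.univ : Set (ι → F)).ncard := by
    rw [Set.ncard_univ]; simp [Nat.card_eq_fintype_card]
  have ht : ∀ (s : F) (v : ι → F), (s • Matrix.vecMulVec v v)ᵀ = s • Matrix.vecMulVec v v := by
    intro s v; ext i j; simp [Matrix.vecMulVec_apply, mul_comm]
  rw [h1, h2, symmetricCount, ← Set.ncard_prod, ← Set.ncard_prod]
  refine Set.ncard_congr
    (fun z _ => (z.1, z.2.1, z.2.2 - z.1⁻¹ • Matrix.vecMulVec z.2.1 z.2.1)) ?_ ?_ ?_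
  · rintro ⟨s, v, S⟩ ⟨⟨h, h'⟩, hs⟩
    dsimp only at h h' hs
    rw [det_borderedMatrix hs, IsUnit.mul_iff] at h'
    exact ⟨hs, trivial, h'.2, by dsimp only; rw [Matrix.transpose_sub, h, ht]⟩
  · rintro ⟨s, v, S⟩ ⟨s', v', S'⟩ - - h
    simp only [Prod.mk.injEq] at h
    obtain ⟨rfl, rfl, h⟩ := h
    rw [sub_left_injective h]
  · rintro ⟨s, v, S⟩ ⟨hs, -, h, h'⟩
    dsimp only at hs h h'
    refine ⟨(s, v, S + s⁻¹ • Matrix.vecMulVec v v), ⟨⟨?_, ?_⟩, hs⟩, ?_⟩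
    · dsimp only
      rw [Matrix.transpose_add, h', ht]
    · dsimp only
      rw [det_borderedMatrix hs, add_sub_cancel_right]
      exact (IsUnit.mk0 _ hs).mul h
    · dsimp only
      rw [add_sub_cancel_right]

/-- The number of symmetric `S` for which `[0 ᵗv; v S]` is invertible. -/
noncomputable def isotropicBorderCount (v : ι → F) : ℕ :=
  {S : Matrix ι ι F | Sᵀ = S ∧ IsUnit (borderedMatrix 0 v S).det}.ncard

omit [Fintype F] in
theorem isotropicBorderCount_zero : isotropicBorderCount (0 : ι → F) = 0 := by
  rw [isotropicBorderCount]
  convert Set.ncard_empty (Matrix ι ι F)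
  ext S
  refine ⟨fun h => ?_, fun h => h.elim⟩
  have h2 := h.2
  rw [borderedMatrix, Matrix.replicateRow_zero, Matrix.det_fromBlocks_zero₁₂] at h2
  simp at h2

omit [Fintype F] in
-- Congruence by `diag(1, g)` sends the border `v` to `g v` and `S` to `g S gᵀ`, preserving symmetry
-- and invertibility. As `GL` is transitive on nonzero vectors, a single border then suffices.
theorem isotropicBorderCount_mulVec {g : Matrix ι ι F} (hg : IsUnit g.det) (v : ι → F) :
    isotropicBorderCount (g *ᵥ v) = isotropicBorderCount v := by
  have hgT : IsUnit gᵀ.det := by rwa [Matrix.det_transpose]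
  have h : ∀ S, borderedMatrix 0 (g *ᵥ v) (g * S * gᵀ) =
      Matrix.fromBlocks 1 0 0 g * borderedMatrix 0 v S * Matrix.fromBlocks 1 0 0 gᵀ := by
    intro S
    rw [borderedMatrix, borderedMatrix, Matrix.fromBlocks_multiply, Matrix.fromBlocks_multiply]
    simp only [Matrix.one_mul, Matrix.zero_mul, Matrix.mul_zero, Matrix.mul_one, add_zero,
      zero_add, Matrix.fromBlocks_inj, true_and, and_true]
    constructor
    · ext i j
      simp [Matrix.mul_apply, Matrix.mulVec, dotProduct, mul_comm]
    · ext i j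
      simp [Matrix.mul_apply, Matrix.mulVec, dotProduct]
  have hdet : ∀ S, IsUnit (borderedMatrix 0 (g *ᵥ v) (g * S * gᵀ)).det ↔
      IsUnit (borderedMatrix 0 v S).det := by
    intro S
    rw [h, Matrix.det_mul, Matrix.det_mul, Matrix.det_fromBlocks_zero₁₂,
      Matrix.det_fromBlocks_zero₁₂, Matrix.det_one, one_mul, one_mul, IsUnit.mul_iff,
      IsUnit.mul_iff]
    tauto
  symm
  refine Set.ncard_congr (fun S _ => g * S * gᵀ) ?_ ?_ ?_
  · rintro S ⟨h1, h2⟩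
    refine ⟨?_, (hdet S).2 h2⟩
    rw [Matrix.transpose_mul, Matrix.transpose_mul, Matrix.transpose_transpose, h1,
      Matrix.mul_assoc]
  · intro S S' _ _ h
    have := congrArg (fun X => g⁻¹ * X * gᵀ⁻¹) h
    simpa only [Matrix.mul_assoc, Matrix.mul_nonsing_inv _ hgT, Matrix.mul_one,
      Matrix.nonsing_inv_mul_cancel_left _ _ hg] using this
  · rintro S ⟨h1, h2⟩
    have h3 : g * (g⁻¹ * S * gᵀ⁻¹) * gᵀ = S := by
      simp only [Matrix.mul_assoc, Matrix.nonsing_inv_mul _ hgT, Matrix.mul_one,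
        Matrix.mul_nonsing_inv_cancel_left _ _ hg]
    refine ⟨g⁻¹ * S * gᵀ⁻¹, ⟨?_, ?_⟩, h3⟩
    · rw [Matrix.transpose_mul, Matrix.transpose_mul, h1, Matrix.transpose_nonsing_inv,
        Matrix.transpose_nonsing_inv, Matrix.transpose_transpose, Matrix.mul_assoc]
    · rw [← hdet, h3]
      exact h2

omit [Fintype F] in
theorem exists_mulVec_single_eq (j : ι) {v : ι → F} (hv : v ≠ 0) :
    ∃ g : Matrix ι ι F, IsUnit g.det ∧ g *ᵥ Pi.single j 1 = v := by
  obtain ⟨i, hi⟩ := Function.ne_iff.1 hv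
  -- The identity with column `i` replaced by `v` has determinant `v i ≠ 0`; the swap moves that
  -- column to position `j`.
  refine ⟨(Matrix.updateCol 1 i v).submatrix id (Equiv.swap j i), ?_, ?_⟩
  · rw [Matrix.det_permute', IsUnit.mul_iff, ← Matrix.cramer_apply, Matrix.cramer_one]
    refine ⟨?_, IsUnit.mk0 _ hi⟩
    rcases Int.units_eq_one_or (Equiv.Perm.sign (Equiv.swap j i)) with h | h <;> simp [h]
  · rw [Matrix.mulVec_single_one]
    ext k
    simp

omit [Fintype F] in
-- The corner `[0 1; 1 a]` has inverse `[-a 1; 1 0]`. The border `w` meets only the lower right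
-- entry of that inverse, which is zero, so the Schur complement is `S` itself, whatever `a` and `w`
-- are.
theorem isUnit_det_borderedMatrix_borderedMatrix (a : F) (w : ι → F) (S : Matrix ι ι F) :
    IsUnit (borderedMatrix 0 (Pi.single (Sum.inl ()) 1) (borderedMatrix a w S)).det ↔
      IsUnit S.det := by
  have h1 : (Matrix.fromBlocks 0 1 1 (Matrix.of fun _ _ => a) :
      Matrix (Unit ⊕ Unit) (Unit ⊕ Unit) F) *
      Matrix.fromBlocks (Matrix.of fun _ _ => -a) 1 1 0 = 1 := by
    rw [Matrix.fromBlocks_multiply, ← Matrix.fromBlocks_one, Matrix.fromBlocks_inj]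
    refine ⟨by simp, by simp, ?_, by simp⟩
    ext; simp
  let _ : Invertible (Matrix.fromBlocks 0 1 1 (Matrix.of fun _ _ => a) :
      Matrix (Unit ⊕ Unit) (Unit ⊕ Unit) F) := ⟨_, mul_eq_one_comm.1 h1, h1⟩
  have h2 : borderedMatrix 0 (Pi.single (Sum.inl ()) 1) (borderedMatrix a w S) =
      (Matrix.fromBlocks (Matrix.fromBlocks 0 1 1 (Matrix.of fun _ _ => a) :
        Matrix (Unit ⊕ Unit) (Unit ⊕ Unit) F)
        (Matrix.fromRows 0 (Matrix.replicateRow Unit w))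
        (Matrix.fromCols 0 (Matrix.replicateCol Unit w)) S).submatrix
        (Equiv.sumAssoc Unit Unit ι).symm (Equiv.sumAssoc Unit Unit ι).symm := by
    ext (i | i | i) (j | j | j) <;> simp [borderedMatrix]
  rw [h2, Matrix.det_submatrix_equiv_self, Matrix.det_fromBlocks₁₁]
  have h4 : (Matrix.fromCols (0 : Matrix ι Unit F) (Matrix.replicateCol Unit w)) *
      ⅟(Matrix.fromBlocks 0 1 1 (Matrix.of fun _ _ => a) :
      Matrix (Unit ⊕ Unit) (Unit ⊕ Unit) F) *
        (Matrix.fromRows (0 : Matrix Unit ι F) (Matrix.replicateRow Unit w)) = 0 := by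
    have h5 : ⅟(Matrix.fromBlocks 0 1 1 (Matrix.of fun _ _ => a) :
      Matrix (Unit ⊕ Unit) (Unit ⊕ Unit) F) =
        Matrix.fromBlocks (Matrix.of fun _ _ => -a) 1 1 0 := rfl
    rw [h5]
    rw [Matrix.fromCols_mul_fromBlocks, Matrix.fromCols_mul_fromRows]
    simp
  rw [h4, sub_zero, IsUnit.mul_iff]
  exact and_iff_right (Matrix.isUnit_det_of_invertible _)

theorem isotropicBorderCount_single :
    isotropicBorderCount (Pi.single (Sum.inl ()) 1 : Unit ⊕ ι → F) =
      Fintype.card F ^ (Fintype.card ι + 1) * symmetricCount F ι := by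
  have h1 : Fintype.card F ^ (Fintype.card ι + 1) =
      (Set.univ : Set (F × (ι → F))).ncard := by
    rw [Set.ncard_univ]; simp [Nat.card_eq_fintype_card, pow_succ']
  rw [h1, symmetricCount, ← Set.ncard_prod, isotropicBorderCount]
  symm
  refine Set.ncard_congr (fun z _ => borderedMatrix z.1.1 z.1.2 z.2) ?_ ?_ ?_
  · rintro ⟨⟨a, w⟩, S⟩ ⟨-, h, h'⟩
    refine ⟨?_, ?_⟩
    · rw [transpose_borderedMatrix]
      exact borderedMatrix_inj.2 ⟨rfl, rfl, h'⟩
    · rw [isUnit_det_borderedMatrix_borderedMatrix]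
      exact h
  · rintro ⟨⟨a, w⟩, S⟩ ⟨⟨a', w'⟩, S'⟩ - - h
    obtain ⟨rfl, rfl, rfl⟩ := borderedMatrix_inj.1 h
    rfl
  · rintro S ⟨h1, h2⟩
    obtain ⟨a, w, S, h, rfl⟩ := exists_eq_borderedMatrix h1
    rw [isUnit_det_borderedMatrix_borderedMatrix] at h2
    exact ⟨((a, w), S), ⟨trivial, h2, h⟩, rfl⟩

theorem symmetricCount_unit_sum :
    symmetricCount F (Unit ⊕ ι) =
      (Fintype.card F - 1) * (Fintype.card F ^ Fintype.card ι * symmetricCount F ι) +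
        ∑ v : ι → F, isotropicBorderCount v := by
  classical
  have h : symmetricCount F (Unit ⊕ ι) = {z : F × (ι → F) × Matrix ι ι F | z.2.2ᵀ = z.2.2 ∧
      IsUnit (borderedMatrix z.1 z.2.1 z.2.2).det}.ncard := by
    symm
    refine Set.ncard_congr (fun z _ => borderedMatrix z.1 z.2.1 z.2.2) ?_ ?_ ?_
    · rintro ⟨s, v, S⟩ ⟨h1, h2⟩
      refine ⟨h2, ?_⟩
      rw [transpose_borderedMatrix]
      exact borderedMatrix_inj.2 ⟨rfl, rfl, h1⟩
    · rintro ⟨s, v, S⟩ ⟨s', v', S'⟩ - - h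
      obtain ⟨rfl, rfl, rfl⟩ := borderedMatrix_inj.1 h
      rfl
    · rintro S ⟨h1, h2⟩
      obtain ⟨s, v, S, h, rfl⟩ := exists_eq_borderedMatrix h2
      exact ⟨(s, v, S), ⟨h, h1⟩, rfl⟩
  have h' : {z : F × (ι → F) × Matrix ι ι F | (z.2.2ᵀ = z.2.2 ∧
      IsUnit (borderedMatrix z.1 z.2.1 z.2.2).det) ∧ z.1 = 0}.ncard =
        ∑ v : ι → F, isotropicBorderCount v := by
    have h2 := ncard_fibrewise (Finset.univ : Finset (ι → F))
      (fun v => {S : Matrix ι ι F | Sᵀ = S ∧ IsUnit (borderedMatrix 0 v S).det})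
    refine Eq.trans ?_ h2
    refine Set.ncard_congr (fun z _ => z.2) ?_ ?_ ?_
    · rintro ⟨s, v, S⟩ ⟨⟨h1, h2⟩, rfl⟩
      exact ⟨Finset.mem_univ _, h1, h2⟩
    · rintro ⟨s, v, S⟩ ⟨s', v', S'⟩ ⟨-, rfl⟩ ⟨-, rfl⟩ h
      dsimp only at h ⊢
      rw [h]
    · rintro ⟨v, S⟩ ⟨-, h1, h2⟩
      exact ⟨(0, v, S), ⟨⟨h1, h2⟩, rfl⟩, rfl⟩
  rw [h, ← ncard_borderedMatrix_corner_ne_zero, ← h', ← Set.ncard_union_eq]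
  · congr 1
    ext z
    simp only [Set.mem_ofPred_eq, Set.mem_union]
    tauto
  · rw [Set.disjoint_left]
    rintro z ⟨-, h1⟩ ⟨-, h2⟩
    exact h1 h2

omit ι [Fintype ι] [DecidableEq ι]

theorem symmetricCount_one : symmetricCount F (Fin 1) = Fintype.card F - 1 := by
  classical
  rw [symmetricCount_congr (F := F) (Fintype.equivOfCardEq (by simp) : Fin 1 ≃ Unit ⊕ Fin 0),
    symmetricCount_unit_sum, symmetricCount_of_isEmpty, Fintype.sum_unique,
    Subsingleton.elim (default : Fin 0 → F) 0, isotropicBorderCount_zero]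
  simp

/-- The first summand counts a nonzero corner entry. If that entry is zero, the border must be one
of the `q ^ (n + 1) - 1` nonzero vectors, and each can be moved to a basis vector. -/
theorem symmetricCount_add_two (n : ℕ) :
    symmetricCount F (Fin (n + 2)) =
      (Fintype.card F - 1) * Fintype.card F ^ (n + 1) * symmetricCount F (Fin (n + 1)) +
        (Fintype.card F ^ (n + 1) - 1) * Fintype.card F ^ (n + 1) *
          symmetricCount F (Fin n) := by
  classical
  have h : ∀ v ∈ (Finset.univ : Finset (Unit ⊕ Fin n → F)).erase 0,
      isotropicBorderCount v = Fintype.card F ^ (n + 1) * symmetricCount F (Fin n) := by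
    intro v hv
    obtain ⟨g, hg, rfl⟩ := exists_mulVec_single_eq (Sum.inl ()) (Finset.ne_of_mem_erase hv)
    rw [isotropicBorderCount_mulVec hg, isotropicBorderCount_single, Fintype.card_fin]
  rw [symmetricCount_congr (F := F)
      (Fintype.equivOfCardEq (by simp; ring) : Fin (n + 2) ≃ Unit ⊕ (Unit ⊕ Fin n)),
    symmetricCount_unit_sum, symmetricCount_congr (F := F)
      (Fintype.equivOfCardEq (by simp; ring) : Fin (n + 1) ≃ Unit ⊕ Fin n),
    ← Finset.add_sum_erase _ _ (Finset.mem_univ (0 : Unit ⊕ Fin n → F)),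
    isotropicBorderCount_zero, Finset.sum_congr rfl h, Finset.sum_const,
    Finset.card_erase_of_mem (Finset.mem_univ _), Finset.card_univ]
  simp only [Fintype.card_sum, Fintype.card_unit, Fintype.card_fin, Fintype.card_fun, smul_eq_mul,
    add_comm 1 n, zero_add]
  ring

theorem symmetricCount_fin (k : ℕ) :
    (symmetricCount F (Fin (2 * k)) : ℚ) = (Fintype.card F : ℚ) ^ (k * (k + 1)) *
      ∏ j ∈ Finset.Icc 1 k, ((Fintype.card F : ℚ) ^ (2 * j - 1) - 1) ∧
    (symmetricCount F (Fin (2 * k + 1)) : ℚ) = (Fintype.card F : ℚ) ^ (k * (k + 1)) *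
      ∏ j ∈ Finset.Icc 1 (k + 1), ((Fintype.card F : ℚ) ^ (2 * j - 1) - 1) := by
  have hq : 1 ≤ Fintype.card F := Fintype.card_pos
  have hrec : ∀ n, (symmetricCount F (Fin (n + 2)) : ℚ) =
      ((Fintype.card F : ℚ) - 1) * (Fintype.card F : ℚ) ^ (n + 1) *
        symmetricCount F (Fin (n + 1)) +
        ((Fintype.card F : ℚ) ^ (n + 1) - 1) * (Fintype.card F : ℚ) ^ (n + 1) *
          symmetricCount F (Fin n) := by
    intro n
    rw [symmetricCount_add_two]
    push_cast [Nat.cast_sub hq, Nat.cast_sub (Nat.one_le_pow (n + 1) _ hq)]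
    ring
  induction k with
  | zero =>
    refine ⟨?_, ?_⟩
    · rw [Nat.mul_zero, symmetricCount_of_isEmpty]; simp
    · rw [Nat.mul_zero, Nat.zero_add, symmetricCount_one]; simp [Nat.cast_sub hq]
  | succ k ih =>
    obtain ⟨h1, h2⟩ := ih
    have h3 : (symmetricCount F (Fin (2 * (k + 1))) : ℚ) =
        (Fintype.card F : ℚ) ^ ((k + 1) * (k + 1 + 1)) *
        ∏ j ∈ Finset.Icc 1 (k + 1), ((Fintype.card F : ℚ) ^ (2 * j - 1) - 1) := by
      rw [show 2 * (k + 1) = 2 * k + 2 by ring, hrec, h1, h2,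
        Finset.prod_Icc_succ_top (by omega), show 2 * (k + 1) - 1 = 2 * k + 1 by omega]
      ring
    refine ⟨h3, ?_⟩
    rw [show 2 * (k + 1) + 1 = (2 * k + 1) + 2 by ring, hrec,
      show 2 * k + 1 + 1 = 2 * (k + 1) by ring, h3, h2,
      Finset.prod_Icc_succ_top (b := k + 1) (by omega),
      show 2 * (k + 1 + 1) - 1 = 2 * k + 3 by omega]
    ring

end SymmetricCount

/-! ### The trace form and quadratic equations in characteristic two -/

section CharTwo

variable {F : Type*} [Field F] [Fintype F] [Algebra (ZMod 2) F]

omit [Fintype F] in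
variable (F) in
theorem charP_two_of_algebra : CharP F 2 :=
  charP_of_injective_algebraMap (algebraMap (ZMod 2) F).injective 2

/-- Squaring is the Frobenius automorphism over the prime field, and the trace is invariant under
automorphisms. -/
theorem absTrace_sq (x : F) : absTrace (x ^ 2) = absTrace x := by
  have h := Algebra.trace_eq_of_algEquiv
    (FiniteField.frobeniusAlgEquivOfAlgebraic (ZMod 2) F) x
  rwa [FiniteField.coe_frobeniusAlgEquivOfAlgebraic, ZMod.card] at h

theorem canonicalChar_sq (x : F) : canonicalChar (x ^ 2) = canonicalChar x := by
  rw [canonicalChar, canonicalChar, absTrace_sq]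

omit [Fintype F] in
theorem absTrace_eq_zero_or_one (x : F) : absTrace x = 0 ∨ absTrace x = 1 := by
  generalize absTrace x = t
  revert t
  decide

omit [Fintype F] in
theorem canonicalChar_of_absTrace_eq_zero {x : F} (h : absTrace x = 0) : canonicalChar x = 1 := by
  rw [canonicalChar, h]; rfl

omit [Fintype F] in
theorem canonicalChar_of_absTrace_eq_one {x : F} (h : absTrace x = 1) :
    canonicalChar x = -1 := by
  rw [canonicalChar, h]; rfl

omit [Fintype F] in
theorem canonicalChar_zero : canonicalChar (0 : F) = 1 :=
  canonicalChar_of_absTrace_eq_zero (map_zero (Algebra.trace (ZMod 2) F))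

/-- The Artin–Schreier map `u ↦ u² + u` as a linear map over the prime field. -/
noncomputable def artinSchreier (F : Type*) [Field F] [Fintype F] [Algebra (ZMod 2) F] :
    F →ₗ[ZMod 2] F :=
  (FiniteField.frobeniusAlgEquivOfAlgebraic (ZMod 2) F).toLinearMap + LinearMap.id

theorem artinSchreier_apply (u : F) : artinSchreier F u = u ^ 2 + u := by
  simp [artinSchreier]

theorem ker_artinSchreier : LinearMap.ker (artinSchreier F) = ZMod 2 ∙ (1 : F) := by
  have := charP_two_of_algebra F
  ext u
  rw [LinearMap.mem_ker, artinSchreier_apply, Submodule.mem_span_singleton]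
  constructor
  · intro h
    have h' : u * (u + 1) = 0 := by rw [← h]; ring
    rcases mul_eq_zero.1 h' with h | h
    · exact ⟨0, by simp [h]⟩
    · exact ⟨1, by rw [one_smul, (CharTwo.add_eq_zero.1 h)]⟩
  · rintro ⟨a, rfl⟩
    have : a = 0 ∨ a = 1 := by revert a; decide
    rcases this with rfl | rfl
    · simp
    · rw [one_smul, one_pow, CharTwo.add_self_eq_zero]

/-- Additive Hilbert 90 by dimension: the range lies in the kernel of the trace, and both have
codimension one, since the Artin–Schreier kernel is the prime field and the trace is onto. -/
theorem range_artinSchreier :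
    LinearMap.range (artinSchreier F) = LinearMap.ker (Algebra.trace (ZMod 2) F) := by
  refine Submodule.eq_of_le_of_finrank_eq ?_ ?_
  · rintro _ ⟨u, rfl⟩
    rw [LinearMap.mem_ker, artinSchreier_apply, map_add]
    have : Algebra.trace (ZMod 2) F (u ^ 2) = Algebra.trace (ZMod 2) F u := absTrace_sq u
    rw [this, CharTwo.add_self_eq_zero]
  · have h1 := LinearMap.finrank_range_add_finrank_ker (artinSchreier F)
    have h2 := LinearMap.finrank_range_add_finrank_ker (Algebra.trace (ZMod 2) F)
    rw [ker_artinSchreier, finrank_span_singleton one_ne_zero] at h1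
    rw [LinearMap.range_eq_top.2 (Algebra.trace_surjective (ZMod 2) F), finrank_top,
      Module.finrank_self] at h2
    omega

theorem ncard_sq_add_self (c : F) :
    ({u : F | u ^ 2 + u = c}.ncard : ℤ) = 1 + canonicalChar c := by
  have := charP_two_of_algebra F
  rcases absTrace_eq_zero_or_one c with h | h
  · rw [canonicalChar_of_absTrace_eq_zero h]
    have hc : c ∈ LinearMap.range (artinSchreier F) := by
      rw [range_artinSchreier]; exact h
    obtain ⟨v, hv⟩ := hc
    rw [artinSchreier_apply] at hv
    have h2 : {u : F | u ^ 2 + u = c} = {v, v + 1} := by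
      ext u
      simp only [Set.mem_ofPred_eq, Set.mem_insert_iff, Set.mem_singleton_iff]
      rw [← hv]
      constructor
      · intro h
        have h' : (u + v) * (u + (v + 1)) = 0 := by
          have : (u + v) * (u + (v + 1)) = u ^ 2 + u + (v ^ 2 + v) + 2 * (u * v) := by ring
          rw [this, h, CharTwo.two_eq_zero (R := F), zero_mul, add_zero, CharTwo.add_self_eq_zero]
        rcases mul_eq_zero.1 h' with h | h
        · exact Or.inl (CharTwo.add_eq_zero.1 h)
        · exact Or.inr (CharTwo.add_eq_zero.1 h)
      · rintro (rfl | rfl)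
        · rfl
        · have : (v + 1) ^ 2 + (v + 1) = v ^ 2 + v + 2 * (v + 1) := by ring
          rw [this, CharTwo.two_eq_zero (R := F), zero_mul, add_zero]
    rw [h2, Set.ncard_pair]
    · rfl
    · simp
  · rw [canonicalChar_of_absTrace_eq_one h]
    have h2 : {u : F | u ^ 2 + u = c} = ∅ := by
      ext u
      refine ⟨fun hu => ?_, fun hu => hu.elim⟩
      have hc : c ∈ LinearMap.ker (Algebra.trace (ZMod 2) F) := by
        rw [← range_artinSchreier]
        exact ⟨u, by rw [artinSchreier_apply]; exact hu⟩
      have hc' : absTrace c = 0 := hc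
      rw [h] at hc'
      exact one_ne_zero hc'
    rw [h2]
    simp

/-- The fibres of `u ↦ u² + u` partition the field, so `q = ∑ (1 + λ(c))`. -/
theorem sum_canonicalChar : ∑ c : F, canonicalChar c = 0 := by
  have h1 : (Fintype.card F : ℤ) = ∑ c : F, ({u : F | u ^ 2 + u = c}.ncard : ℤ) := by
    classical
    have := Finset.card_eq_sum_card_fiberwise (f := fun u : F => u ^ 2 + u)
      (s := Finset.univ) (t := Finset.univ) (fun _ _ => Finset.mem_coe.2 (Finset.mem_univ _))
    rw [← Finset.card_univ, this, Nat.cast_sum]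
    refine Finset.sum_congr rfl fun c _ => ?_
    rw [← Set.ncard_coe_finset]
    congr 2
    ext; simp
  simp only [ncard_sq_add_self, Finset.sum_add_distrib, Finset.sum_const, Finset.card_univ,
    nsmul_eq_mul, mul_one] at h1
  linarith

end CharTwo

/-! ### Matrices of size one and two -/

section SmallMatrices

variable {F : Type*} [Field F]

/-- The number of `A ∈ GL(m, F)` with `tr A + tr A⁻¹ = b`. -/
noncomputable def traceAddInvCount (m : ℕ) (b : F) : ℕ :=
  {A : Matrix (Fin m) (Fin m) F | IsUnit A.det ∧ A.trace + A⁻¹.trace = b}.ncard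

theorem traceAddInvCount_one (b : F) :
    traceAddInvCount 1 b = {x : F | x ≠ 0 ∧ x + x⁻¹ = b}.ncard := by
  have htr : ∀ A : Matrix (Fin 1) (Fin 1) F, A.trace = A 0 0 := fun A => by
    simp [Matrix.trace]
  have hinv : ∀ A : Matrix (Fin 1) (Fin 1) F, A⁻¹ 0 0 = (A 0 0)⁻¹ := fun A => by
    rw [Matrix.inv_def, Matrix.adjugate_fin_one, Matrix.det_fin_one]
    simp
  rw [traceAddInvCount]
  refine Set.ncard_congr (fun A _ => A 0 0) ?_ ?_ ?_
  · rintro A ⟨h1, h2⟩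
    rw [Matrix.det_fin_one] at h1
    rw [htr, htr, hinv] at h2
    exact ⟨h1.ne_zero, h2⟩
  · intro A A' _ _ h
    ext i j
    rw [Subsingleton.elim i 0, Subsingleton.elim j 0]
    exact h
  · rintro x ⟨h1, h2⟩
    refine ⟨Matrix.of fun _ _ => x, ⟨?_, ?_⟩, rfl⟩
    · rw [Matrix.det_fin_one]
      exact IsUnit.mk0 _ h1
    · rw [htr, htr, hinv]
      exact h2

section

variable [Fintype F] [Algebra (ZMod 2) F]

omit [Fintype F] in
theorem traceAddInvCount_one_zero : traceAddInvCount 1 (0 : F) = 1 := by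
  have := charP_two_of_algebra F
  rw [traceAddInvCount_one, Set.ncard_eq_one]
  refine ⟨1, ?_⟩
  ext x
  simp only [Set.mem_ofPred_eq, Set.mem_singleton_iff, CharTwo.add_eq_zero]
  constructor
  · rintro ⟨h1, h2⟩
    have h3 : x * x = 1 := by
      nth_rw 2 [h2]
      exact mul_inv_cancel₀ h1
    rcases mul_self_eq_one_iff.1 h3 with h | h
    · exact h
    · rw [h, CharTwo.neg_eq]
  · rintro rfl
    simp

/-- Putting `x = b u` in `x² + b x + 1 = 0` gives `u² + u = b⁻²`, and `λ(b⁻²) = λ(b⁻¹)`. -/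
theorem traceAddInvCount_one_of_ne_zero {b : F} (hb : b ≠ 0) :
    (traceAddInvCount 1 b : ℤ) = 1 + canonicalChar b⁻¹ := by
  have := charP_two_of_algebra F
  rw [traceAddInvCount_one, ← canonicalChar_sq, ← ncard_sq_add_self]
  congr 1
  refine Set.ncard_congr (fun x _ => x * b⁻¹) ?_ ?_ ?_
  · rintro x ⟨h1, h2⟩
    have h3 : x ^ 2 = b * x + 1 := by
      rw [← h2, add_mul, inv_mul_cancel₀ h1, add_assoc, CharTwo.add_self_eq_zero]
      ring
    change (x * b⁻¹) ^ 2 + x * b⁻¹ = b⁻¹ ^ 2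
    rw [mul_pow, h3]
    have : (b * x + 1) * b⁻¹ ^ 2 + x * b⁻¹ = b⁻¹ ^ 2 + (x * b⁻¹ + x * b⁻¹) := by
      field_simp
      ring
    rw [this, CharTwo.add_self_eq_zero, add_zero]
  · intro x y _ _ h
    exact mul_right_cancel₀ (inv_ne_zero hb) h
  · intro u hu
    change u ^ 2 + u = b⁻¹ ^ 2 at hu
    have hu0 : u ≠ 0 := by
      rintro rfl
      exact pow_ne_zero 2 (inv_ne_zero hb) (by rw [← hu]; ring)
    refine ⟨u * b, ⟨mul_ne_zero hu0 hb, ?_⟩, by field_simp⟩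
    have h2 : b ^ 2 * u ^ 2 + b ^ 2 * u = 1 := by
      rw [← mul_add, hu]
      field_simp
    field_simp
    linear_combination h2 + (1 - u * b ^ 2) * CharTwo.two_eq_zero (R := F)

end

/-! ### Size two: matrices with prescribed trace and determinant. -/

theorem ncard_mul_eq [Fintype F] [DecidableEq F] (y : F) :
    ({z : F × F | z.1 * z.2 = y}.ncard : ℤ) =
      Fintype.card F - 1 + if y = 0 then (Fintype.card F : ℤ) else 0 := by
  have h := ncard_fibrewise (Finset.univ : Finset F) (fun b => {c : F | b * c = y})
  have h0 : {z : F × F | z.1 * z.2 = y} =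
      {z : F × F | z.1 ∈ (Finset.univ : Finset F) ∧ z.2 ∈ {c : F | z.1 * c = y}} := by
    ext z; simp
  have h1 : ∀ b ∈ (Finset.univ : Finset F).erase 0, {c : F | b * c = y}.ncard = 1 := by
    intro b hb
    have hb' := Finset.ne_of_mem_erase hb
    rw [Set.ncard_eq_one]
    refine ⟨b⁻¹ * y, ?_⟩
    ext c
    simp only [Set.mem_ofPred_eq, Set.mem_singleton_iff]
    rw [eq_inv_mul_iff_mul_eq₀ hb']
  have h2 : ({c : F | (0 : F) * c = y}.ncard : ℤ) =
      if y = 0 then (Fintype.card F : ℤ) else 0 := by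
    split_ifs with hy
    · simp [hy, Set.ncard_univ, Nat.card_eq_fintype_card]
    · simp [eq_comm, hy]
  rw [h0, h, ← Finset.add_sum_erase _ _ (Finset.mem_univ (0 : F)), Finset.sum_congr rfl h1]
  push_cast
  rw [h2, Finset.sum_const, Finset.card_erase_of_mem (Finset.mem_univ _), Finset.card_univ]
  rw [nsmul_eq_mul, mul_one, Nat.cast_sub Fintype.card_pos]
  push_cast
  ring

/-- Fixing one diagonal entry `a` determines the other, and leaves the product `a (t - a) - d` of
the off-diagonal entries; a zero product has `q` more solutions than a nonzero one. -/
theorem ncard_trace_det [Fintype F] (t d : F) :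
    ({A : Matrix (Fin 2) (Fin 2) F | A.trace = t ∧ A.det = d}.ncard : ℤ) =
      Fintype.card F * (Fintype.card F - 1) +
        Fintype.card F * {a : F | a * (t - a) = d}.ncard := by
  classical
  have h := ncard_fibrewise (Finset.univ : Finset F)
    (fun a => {z : F × F | z.1 * z.2 = a * (t - a) - d})
  have h0 : {A : Matrix (Fin 2) (Fin 2) F | A.trace = t ∧ A.det = d}.ncard =
      {z : F × F × F | z.1 ∈ (Finset.univ : Finset F) ∧
        z.2 ∈ {x : F × F | x.1 * x.2 = z.1 * (t - z.1) - d}}.ncard := by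
    refine Set.ncard_congr (fun A _ => (A 0 0, A 0 1, A 1 0)) ?_ ?_ ?_
    · rintro A ⟨h1, h2⟩
      rw [Matrix.trace_fin_two] at h1
      rw [Matrix.det_fin_two] at h2
      refine ⟨Finset.mem_univ _, ?_⟩
      change A 0 1 * A 1 0 = A 0 0 * (t - A 0 0) - d
      rw [← h1, ← h2]
      ring
    · rintro A A' ⟨h1, -⟩ ⟨h1', -⟩ h
      simp only [Prod.mk.injEq] at h
      obtain ⟨h3, h4, h5⟩ := h
      rw [Matrix.trace_fin_two] at h1 h1'
      have h6 : A 1 1 = A' 1 1 := by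
        rw [← h1', h3] at h1
        exact add_left_cancel h1
      ext i j
      fin_cases i <;> fin_cases j <;> assumption
    · rintro ⟨a, b, c⟩ ⟨-, h⟩
      change b * c = a * (t - a) - d at h
      refine ⟨!![a, b; c, t - a], ⟨?_, ?_⟩, ?_⟩
      · rw [Matrix.trace_fin_two_of]; ring
      · rw [Matrix.det_fin_two_of, h]; ring
      · simp
  rw [h0, h]
  push_cast
  simp only [ncard_mul_eq, Finset.sum_add_distrib, Finset.sum_const, Finset.card_univ,
    nsmul_eq_mul]
  congr 1
  rw [← Finset.sum_filter, Finset.sum_const, nsmul_eq_mul, mul_comm]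
  congr 2
  rw [← Set.ncard_coe_finset]
  congr 1
  ext a
  simp [sub_eq_zero]

variable [Fintype F] [Algebra (ZMod 2) F]

theorem ncard_trace_zero_det (d : F) :
    ({A : Matrix (Fin 2) (Fin 2) F | A.trace = 0 ∧ A.det = d}.ncard : ℤ) =
      (Fintype.card F : ℤ) ^ 2 := by
  have := charP_two_of_algebra F
  have h : {a : F | a * (0 - a) = d}.ncard = 1 := by
    rw [Set.ncard_eq_one]
    have hf : Function.Bijective (fun a : F => a ^ 2) :=
      (Finite.injective_iff_bijective).1 (frobenius_inj F 2)
    obtain ⟨a, ha⟩ := hf.2 d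
    refine ⟨a, ?_⟩
    ext x
    simp only [Set.mem_ofPred_eq, Set.mem_singleton_iff, zero_sub, CharTwo.neg_eq]
    rw [← ha, ← sq]
    exact hf.1.eq_iff
  rw [ncard_trace_det, h]
  push_cast
  ring

theorem ncard_trace_det_of_ne_zero {t : F} (ht : t ≠ 0) (d : F) :
    ({A : Matrix (Fin 2) (Fin 2) F | A.trace = t ∧ A.det = d}.ncard : ℤ) =
      (Fintype.card F : ℤ) ^ 2 + Fintype.card F * canonicalChar (d / t ^ 2) := by
  have := charP_two_of_algebra F
  have h : {a : F | a * (t - a) = d}.ncard = {u : F | u ^ 2 + u = d / t ^ 2}.ncard := by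
    refine Set.ncard_congr (fun a _ => a / t) ?_ ?_ ?_
    · intro a ha
      change a * (t - a) = d at ha
      change (a / t) ^ 2 + a / t = d / t ^ 2
      rw [← ha, CharTwo.sub_eq_add]
      field_simp
      ring
    · intro a a' _ _ h
      exact (div_left_inj' ht).1 h
    · intro u hu
      change u ^ 2 + u = d / t ^ 2 at hu
      refine ⟨u * t, ?_, by field_simp⟩
      change u * t * (t - u * t) = d
      rw [eq_div_iff (pow_ne_zero 2 ht)] at hu
      rw [← hu, CharTwo.sub_eq_add]
      ring
  rw [ncard_trace_det, h, ncard_sq_add_self]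
  ring

theorem ncard_det_eq_one :
    ({A : Matrix (Fin 2) (Fin 2) F | A.det = 1}.ncard : ℤ) =
      (Fintype.card F : ℤ) ^ 3 - Fintype.card F := by
  classical
  have := charP_two_of_algebra F
  have h := ncard_fibrewise (Finset.univ : Finset F)
    (fun t => {A : Matrix (Fin 2) (Fin 2) F | A.trace = t ∧ A.det = 1})
  have h0 : {A : Matrix (Fin 2) (Fin 2) F | A.det = 1}.ncard =
      {z : F × Matrix (Fin 2) (Fin 2) F | z.1 ∈ (Finset.univ : Finset F) ∧
        z.2 ∈ {A : Matrix (Fin 2) (Fin 2) F | A.trace = z.1 ∧ A.det = 1}}.ncard := by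
    refine Set.ncard_congr (fun A _ => (A.trace, A)) ?_ ?_ ?_
    · intro A hA
      exact ⟨Finset.mem_univ _, rfl, hA⟩
    · intro A A' _ _ h
      exact (Prod.mk.injEq _ _ _ _ ▸ h).2
    · rintro ⟨t, A⟩ ⟨-, ht, hA⟩
      exact ⟨A, hA, Prod.ext ht rfl⟩
  have h1 : ∀ t ∈ (Finset.univ : Finset F).erase 0,
      ({A : Matrix (Fin 2) (Fin 2) F | A.trace = t ∧ A.det = 1}.ncard : ℤ) =
      (Fintype.card F : ℤ) ^ 2 + Fintype.card F * canonicalChar t⁻¹ := by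
    intro t ht
    rw [ncard_trace_det_of_ne_zero (Finset.ne_of_mem_erase ht), one_div, ← inv_pow,
      canonicalChar_sq]
  -- The full character sum vanishes, and the omitted term is `λ(0) = 1`.
  have h2 : ∑ t ∈ (Finset.univ : Finset F).erase 0, canonicalChar t⁻¹ = -1 := by
    have h3 := sum_canonicalChar (F := F)
    rw [← Function.Bijective.sum_comp (inv_involutive (G := F)).bijective,
      ← Finset.add_sum_erase _ _ (Finset.mem_univ (0 : F)), inv_zero, canonicalChar_zero] at h3
    linarith
  rw [h0, h, Nat.cast_sum, ← Finset.add_sum_erase _ _ (Finset.mem_univ (0 : F)),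
    Finset.sum_congr rfl h1, ncard_trace_zero_det, Finset.sum_add_distrib, ← Finset.mul_sum, h2,
    Finset.sum_const, Finset.card_erase_of_mem (Finset.mem_univ _), Finset.card_univ, nsmul_eq_mul,
    Nat.cast_sub Fintype.card_pos]
  push_cast
  ring

omit [Algebra (ZMod 2) F] in
-- The adjugate of a `2 × 2` matrix has the same trace, hence `tr A⁻¹ = tr A / det A`; clearing the
-- denominator leaves a linear condition on the trace for each determinant.
theorem traceAddInvCount_two [DecidableEq F] (b : F) :
    traceAddInvCount 2 b = ∑ d : Fˣ,
      {A : Matrix (Fin 2) (Fin 2) F | A.det = d ∧ A.trace * (d + 1) = b * d}.ncard := by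
  have h := ncard_fibrewise (Finset.univ : Finset Fˣ) (fun d =>
    {A : Matrix (Fin 2) (Fin 2) F | A.det = d ∧ A.trace * (d + 1) = b * d})
  rw [← h, traceAddInvCount]
  have key : ∀ (A : Matrix (Fin 2) (Fin 2) F) (d : Fˣ), A.det = d →
      (A.trace + A⁻¹.trace = b ↔ A.trace * (d + 1) = b * d) := by
    intro A d hd
    have h1 : A⁻¹.trace = (d : F)⁻¹ * A.trace := by
      rw [Matrix.inv_def, hd, Matrix.trace_smul, Ring.inverse_eq_inv, Matrix.adjugate_fin_two,
        Matrix.trace_fin_two_of, Matrix.trace_fin_two, smul_eq_mul, add_comm (A 1 1)]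
    rw [h1, ← mul_left_inj' d.ne_zero]
    have h2 : (A.trace + (d : F)⁻¹ * A.trace) * d = A.trace * (d + 1) := by
      field_simp
    rw [h2]
  symm
  refine Set.ncard_congr (fun z _ => z.2) ?_ ?_ ?_
  · rintro ⟨d, A⟩ ⟨-, h1, h2⟩
    exact ⟨by dsimp only at h1 ⊢; rw [h1]; exact d.isUnit, (key A d h1).2 h2⟩
  · rintro ⟨d, A⟩ ⟨d', A'⟩ ⟨-, h1, -⟩ ⟨-, h1', -⟩ h
    dsimp only at h h1 h1'
    subst h
    rw [h1] at h1'
    rw [Units.ext h1']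
  · rintro A ⟨h1, h2⟩
    obtain ⟨d, hd⟩ := h1
    exact ⟨(d, A), ⟨Finset.mem_univ _, hd.symm, (key A d hd.symm).1 h2⟩, rfl⟩

/-- Each of the `q - 2` determinants other than `1` forces trace zero; determinant `1` allows all
`q³ - q` matrices. -/
theorem traceAddInvCount_two_zero :
    (traceAddInvCount 2 (0 : F) : ℤ) =
      2 * (Fintype.card F : ℤ) ^ 3 - 2 * (Fintype.card F : ℤ) ^ 2 - Fintype.card F := by
  classical
  have := charP_two_of_algebra F
  have h1 : ∀ d ∈ (Finset.univ : Finset Fˣ).erase 1,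
      ({A : Matrix (Fin 2) (Fin 2) F | A.det = d ∧ A.trace * (d + 1) = 0 * d}.ncard : ℤ) =
        (Fintype.card F : ℤ) ^ 2 := by
    intro d hd
    have hd1 : (d : F) + 1 ≠ 0 := by
      rw [Ne, CharTwo.add_eq_zero]
      exact fun h => Finset.ne_of_mem_erase hd (Units.ext h)
    rw [← ncard_trace_zero_det (d : F)]
    congr 2
    ext A
    simp [hd1, and_comm]
  have h2 : {A : Matrix (Fin 2) (Fin 2) F | A.det = ((1 : Fˣ) : F) ∧
      A.trace * (((1 : Fˣ) : F) + 1) = 0 * ((1 : Fˣ) : F)} = {A | A.det = 1} := by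
    ext A
    simp [CharTwo.add_self_eq_zero]
  have hq : 2 ≤ Fintype.card F := Fintype.one_lt_card
  rw [traceAddInvCount_two, Nat.cast_sum, ← Finset.add_sum_erase _ _ (Finset.mem_univ (1 : Fˣ)),
    Finset.sum_congr rfl h1, h2, ncard_det_eq_one, Finset.sum_const,
    Finset.card_erase_of_mem (Finset.mem_univ _), Finset.card_univ, Fintype.card_units,
    nsmul_eq_mul, Nat.sub_sub, Nat.cast_sub hq]
  push_cast
  ring

/-- In characteristic two the argument equals `b⁻² (d + d⁻¹)`. With `d = b² c⁴` it becomes `(c + b⁻¹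
c⁻¹)⁴`, and `λ` does not change under squaring; the substitution is a bijection because Frobenius is
injective. -/
theorem sum_canonicalChar_eq_kloosterman {b : F} (hb : b ≠ 0) [Fintype Fˣ] :
    ∑ d : Fˣ, canonicalChar (((d : F) + 1) ^ 2 / (b ^ 2 * d)) = kloosterman b⁻¹ := by
  have := charP_two_of_algebra F
  have hinj : Function.Injective (fun c : Fˣ => Units.mk0 b hb ^ 2 * c ^ 4) := by
    intro c c' h
    have h1 := mul_left_cancel h
    have h2 : ((c : F) ^ 2) ^ 2 = ((c' : F) ^ 2) ^ 2 := by
      have := congrArg (fun u : Fˣ => (u : F)) h1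
      push_cast at this
      rw [← pow_mul, ← pow_mul]
      exact this
    exact Units.ext (frobenius_inj F 2 (frobenius_inj F 2 h2))
  rw [kloosterman, ← Function.Bijective.sum_comp (Finite.injective_iff_bijective.1 hinj)]
  refine Finset.sum_congr (by ext; simp) fun c _ => ?_
  rw [← canonicalChar_sq ((c : F) + _), ← canonicalChar_sq (((c : F) + _) ^ 2)]
  congr 1
  have hc := c.ne_zero
  push_cast
  rw [CharTwo.add_sq, CharTwo.add_sq, CharTwo.add_sq]
  simp only [Units.val_mk0]
  field_simp

theorem traceAddInvCount_two_of_ne_zero {b : F} (hb : b ≠ 0) :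
    (traceAddInvCount 2 b : ℤ) =
      (Fintype.card F : ℤ) ^ 3 - 2 * (Fintype.card F : ℤ) ^ 2 - Fintype.card F +
        Fintype.card F * kloosterman b⁻¹ := by
  classical
  have := charP_two_of_algebra F
  have h1 : ∀ d ∈ (Finset.univ : Finset Fˣ).erase 1,
      ({A : Matrix (Fin 2) (Fin 2) F | A.det = d ∧ A.trace * (d + 1) = b * d}.ncard : ℤ) =
        (Fintype.card F : ℤ) ^ 2 +
          Fintype.card F * canonicalChar (((d : F) + 1) ^ 2 / (b ^ 2 * d)) := by
    intro d hd
    have hd0 := d.ne_zero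
    have hd1 : (d : F) + 1 ≠ 0 := by
      rw [Ne, CharTwo.add_eq_zero]
      exact fun h => Finset.ne_of_mem_erase hd (Units.ext h)
    have ht : b * d / (d + 1) ≠ 0 := div_ne_zero (mul_ne_zero hb hd0) hd1
    have h2 : ((d : F) + 1) ^ 2 / (b ^ 2 * d) = d / (b * d / (d + 1)) ^ 2 := by
      field_simp
    rw [h2, ← ncard_trace_det_of_ne_zero ht]
    congr 2
    ext A
    simp only [Set.mem_ofPred_eq]
    rw [eq_div_iff hd1, and_comm]
  -- Determinant `1` would force `b = 0`. The complete Kloosterman sum still contains the value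
  -- `λ(0) = 1` at `d = 1`, which must be subtracted.
  have h2 : {A : Matrix (Fin 2) (Fin 2) F | A.det = ((1 : Fˣ) : F) ∧
      A.trace * (((1 : Fˣ) : F) + 1) = b * ((1 : Fˣ) : F)} = ∅ := by
    ext A
    simp [CharTwo.add_self_eq_zero, hb.symm]
  have h3 := sum_canonicalChar_eq_kloosterman hb
  rw [← Finset.add_sum_erase _ _ (Finset.mem_univ (1 : Fˣ)), Units.val_one,
    CharTwo.add_self_eq_zero, zero_pow two_ne_zero, zero_div, canonicalChar_zero] at h3
  have hq : 2 ≤ Fintype.card F := Fintype.one_lt_card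
  rw [traceAddInvCount_two, Nat.cast_sum, ← Finset.add_sum_erase _ _ (Finset.mem_univ (1 : Fˣ)),
    Finset.sum_congr rfl h1, h2, Set.ncard_empty, Finset.sum_add_distrib, Finset.sum_const,
    ← Finset.mul_sum, eq_sub_of_add_eq' h3,
    Finset.card_erase_of_mem (Finset.mem_univ _), Finset.card_univ, Fintype.card_units,
    nsmul_eq_mul, Nat.sub_sub, Nat.cast_sub hq]
  push_cast
  ring

end SmallMatrices

/-! ### Assembling the count -/

section Assembly

variable {F : Type*} [Field F] [Fintype F]

/-- The product `∏ (q ^ i - 1)` over `1 ≤ i ≤ n`. -/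
def qFactorial (q : ℚ) (n : ℕ) : ℚ := ∏ i ∈ Finset.Icc 1 n, (q ^ i - 1)

theorem qFactorial_succ (q : ℚ) (n : ℕ) :
    qFactorial q (n + 1) = qFactorial q n * (q ^ (n + 1) - 1) :=
  Finset.prod_Icc_succ_top (by omega) _

theorem qFactorial_one (q : ℚ) : qFactorial q 1 = q - 1 := by simp [qFactorial]

theorem qFactorial_two (q : ℚ) : qFactorial q 2 = (q - 1) * (q ^ 2 - 1) := by
  rw [qFactorial_succ, qFactorial_one]

theorem qFactorial_ne_zero {q : ℚ} (hq : 1 < q) (n : ℕ) : qFactorial q n ≠ 0 :=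
  Finset.prod_ne_zero_iff.2 fun i hi =>
    (sub_pos.2 (one_lt_pow₀ hq (by have := (Finset.mem_Icc.1 hi).1; omega))).ne'

theorem qFactorial_two_mul (q : ℚ) (k : ℕ) :
    qFactorial q (2 * k) = (∏ j ∈ Finset.Icc 1 k, (q ^ (2 * j - 1) - 1)) *
      ∏ j ∈ Finset.Icc 1 k, (q ^ (2 * j) - 1) := by
  induction k with
  | zero => simp [qFactorial]
  | succ k ih =>
    rw [show 2 * (k + 1) = 2 * k + 1 + 1 by ring, qFactorial_succ, qFactorial_succ, ih,
      Finset.prod_Icc_succ_top (by omega), Finset.prod_Icc_succ_top (by omega),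
      show 2 * (k + 1) - 1 = 2 * k + 1 by omega, show 2 * (k + 1) = 2 * k + 1 + 1 by ring]
    ring

variable (F) in
theorem ncard_isUnit_det (n : ℕ) :
    ({A : Matrix (Fin n) (Fin n) F | IsUnit A.det}.ncard : ℚ) =
      (Fintype.card F : ℚ) ^ n.choose 2 * qFactorial (Fintype.card F) n := by
  have h1 : {A : Matrix (Fin n) (Fin n) F | IsUnit A.det}.ncard =
      Nat.card (Matrix.GeneralLinearGroup (Fin n) F) := by
    rw [← Set.ncard_univ]
    symm
    refine Set.ncard_congr (fun u _ => (u : Matrix (Fin n) (Fin n) F)) ?_ ?_ ?_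
    · intro u _
      exact (Matrix.isUnit_iff_isUnit_det _).1 u.isUnit
    · intro u v _ _ h
      exact Units.ext h
    · intro A hA
      obtain ⟨u, hu⟩ := (Matrix.isUnit_iff_isUnit_det A).2 hA
      exact ⟨u, trivial, hu⟩
  have hq : 1 ≤ Fintype.card F := Fintype.card_pos
  rw [h1, Matrix.card_GL_field, Fin.prod_univ_eq_prod_range
    (fun i => Fintype.card F ^ n - Fintype.card F ^ i)]
  have h2 : ∀ i ∈ Finset.range n, ((Fintype.card F ^ n - Fintype.card F ^ i : ℕ) : ℚ) =
      (Fintype.card F : ℚ) ^ i * ((Fintype.card F : ℚ) ^ (n - 1 - i + 1) - 1) := by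
    intro i hi
    have hi := Finset.mem_range.1 hi
    rw [Nat.cast_sub (Nat.pow_le_pow_right hq hi.le), mul_sub, ← pow_add,
      show i + (n - 1 - i + 1) = n by omega]
    push_cast
    ring
  rw [Nat.cast_prod, Finset.prod_congr rfl h2, Finset.prod_mul_distrib,
    Finset.prod_pow_eq_pow_sum, Finset.sum_range_id, ← Nat.choose_two_right,
    Finset.prod_range_reflect (fun i => (Fintype.card F : ℚ) ^ (i + 1) - 1) n, qFactorial,
    Finset.range_eq_Ico, Finset.prod_Ico_add' (fun i => (Fintype.card F : ℚ) ^ i - 1)]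
  rfl

theorem one_lt_card_rat : (1 : ℚ) < Fintype.card F := by
  exact_mod_cast Fintype.one_lt_card

theorem add_choose_two (r m : ℕ) :
    (r + m).choose 2 = r.choose 2 + m.choose 2 + r * m := by
  induction m with
  | zero => simp
  | succ m ih =>
    rw [← add_assoc, Nat.choose_succ_succ' _ 1, Nat.choose_succ_succ' m 1, ih,
      Nat.choose_one_right, Nat.choose_one_right]
    ring

/-- The number of elements of trace `b` in the double coset of `σ_r` in size `r + m`. -/
theorem traceCount_mul (r m : ℕ) (b : F) :
    (traceCount (DoubleCoset.doubleCoset (sigmaPlus F (r + m) r) (parabolic F (r + m))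
      (parabolic F (r + m))) b : ℚ) * (qFactorial (Fintype.card F) r *
        qFactorial (Fintype.card F) m) * Fintype.card F =
      qFactorial (Fintype.card F) (r + m) *
        (Fintype.card F : ℚ) ^ (r.choose 2 + (r + m).choose 2) *
        ({A : Matrix (Fin (r + m)) (Fin (r + m)) F | IsUnit A.det}.ncard +
          symmetricCount F (Fin r) * (Fintype.card F : ℚ) ^ (r * m) *
            (Fintype.card F * traceAddInvCount m b -
              {A : Matrix (Fin m) (Fin m) F | IsUnit A.det}.ncard)) := by
  have h1 := ncard_doubleCoset_fiber (parabolic F (r + m))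
    (fun x hx y hy => mul_mem_parabolic hx hy) (·⁻¹) (fun x hx => inv_mem_parabolic hx)
    (sigmaPlus F (r + m) r) (sigmaPlus_mul_self F (r + m) r) Matrix.trace Matrix.trace_mul_comm b
  rw [ncard_parabolic_inter_conj, ncard_parabolic, ncard_headProj_mul_tailProj_eq_zero,
    ncard_alternatingMatrices_add.2, ncard_alternatingMatrices, ncard_alternatingMatrices] at h1
  have h2 := card_mul_ncard_trace_parabolic_mul_sigmaPlus (F := F) (n := r + m) r b
  have h3 := ncard_headSymmetric_cornerTrace (F := F) (r := r) (m := m) (fun _ => True)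
  simp only [and_true, Set.ofPred_mem_eq] at h3
  rw [ncard_headSymmetric_cornerTrace (· = b), h3, ncard_alternatingMatrices] at h2
  change traceCount _ b * _ = _ at h1
  rw [← traceAddInvCount] at h2
  have hch : (r + m).choose 2 = r.choose 2 + (r * m + m.choose 2) := by
    rw [add_choose_two]; ring
  have hq : (Fintype.card F : ℚ) ≠ 0 := (zero_lt_one.trans one_lt_card_rat).ne'
  have h1' := congrArg (Nat.cast : ℕ → ℚ) h1
  have h2' := congrArg (Nat.cast : ℕ → ℚ) h2
  push_cast at h1' h2'
  generalize ({p | p ∈ parabolic F (r + m) ∧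
    (p * sigmaPlus F (r + m) r).trace = b}.ncard : ℚ) = M at h1' h2'
  generalize (traceCount (DoubleCoset.doubleCoset (sigmaPlus F (r + m) r) (parabolic F (r + m))
      (parabolic F (r + m))) b : ℚ) = N at h1' ⊢
  have hr := ncard_isUnit_det F r
  have hm := ncard_isUnit_det F m
  have hn := ncard_isUnit_det F (r + m)
  generalize ({A : Matrix (Fin (r + m)) (Fin (r + m)) F | IsUnit A.det}.ncard : ℚ) = gn at *
  generalize ({A : Matrix (Fin m) (Fin m) F | IsUnit A.det}.ncard : ℚ) = gm at *
  generalize ({A : Matrix (Fin r) (Fin r) F | IsUnit A.det}.ncard : ℚ) = gr at *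
  generalize (traceAddInvCount m b : ℚ) = g at *
  generalize (symmetricCount F (Fin r) : ℚ) = s at *
  generalize (Fintype.card F : ℚ) = q at *
  -- This is the order of the stabiliser without its two `qFactorial` factors, to be cancelled from
  -- the double count.
  have hK : q ^ (r * m) * q ^ m.choose 2 * (q ^ r.choose 2 * q ^ m.choose 2 * q ^ (r * m)) ≠ 0 := by
    simp [hq]
  refine mul_right_cancel₀ hK ?_
  have hM : q * M = q ^ (r + m).choose 2 * (gn + s * q ^ (r * m) * (q * g - gm)) := by
    linear_combination h2'
  have e1 : q ^ (r + m).choose 2 = q ^ r.choose 2 * q ^ (r * m) * q ^ m.choose 2 := by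
    rw [hch, pow_add, pow_add]; ring
  calc _ = N * (gr * q ^ (r * m) * gm * (q ^ (r * m) * q ^ m.choose 2)) * q := by
        rw [hr, hm]; ring
    _ = gn * q ^ (r + m).choose 2 * (q * M) := by rw [h1']; ring
    _ = _ := by
        rw [hM]
        -- Only the `|GL_n|` coming from `|P|` is expanded; the one inside the parentheses is part
        -- of the target.
        nth_rw 1 [hn]
        rw [pow_add, e1]
        ring

theorem traceCount_succ (r : ℕ) (b : F) :
    (traceCount (DC1 F (r + 1)) b : ℚ) = (Fintype.card F : ℚ)⁻¹ *
      (qBinomial (Fintype.card F) (r + 1) 1 *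
        (Fintype.card F : ℚ) ^ (r.choose 2 + (r + 1).choose 2 + (r + 1).choose 2) *
        qFactorial (Fintype.card F) (r + 1)) +
      (Fintype.card F : ℚ)⁻¹ * (qBinomial (Fintype.card F) (r + 1) 1 *
        (Fintype.card F : ℚ) ^ (r.choose 2 + (r + 1).choose 2 + r) * symmetricCount F (Fin r)) *
      (Fintype.card F * traceAddInvCount 1 b - (Fintype.card F - 1)) := by
  have h := traceCount_mul r 1 b
  have hq1 : (1 : ℚ) < Fintype.card F := one_lt_card_rat
  have h1 := qFactorial_ne_zero hq1 r
  have hq0 : (Fintype.card F : ℚ) ≠ 0 := (zero_lt_one.trans hq1).ne'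
  have hq2 : (Fintype.card F : ℚ) - 1 ≠ 0 := (sub_pos.2 hq1).ne'
  rw [ncard_isUnit_det, ncard_isUnit_det, qFactorial_one, mul_one] at h
  rw [DC1, Nat.add_sub_cancel]
  have hb : qBinomial (Fintype.card F) (r + 1) 1 =
      ((Fintype.card F : ℚ) ^ (r + 1) - 1) / (Fintype.card F - 1) := by
    simp [qBinomial]
  have h3 := qFactorial_succ (Fintype.card F) r
  rw [← mul_left_inj' hq0, ← mul_left_inj' (mul_ne_zero h1 hq2), hb]
  rw [mul_right_comm, h]
  nth_rw 1 [h3]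
  rw [Nat.choose_succ_self, pow_zero]
  field_simp
  ring

/-- Here `|GL_2| = q (q - 1) (q² - 1)`, so a factor `q` leaves `q g - |GL_2|` and joins the power of
`q`; this explains the `+ 1` in the exponent. The two bracketed products are the future `A B` and
`A`. -/
theorem traceCount_add_two (r : ℕ) (b : F) :
    (traceCount (DC2 F (r + 2)) b : ℚ) = (Fintype.card F : ℚ)⁻¹ *
      (qBinomial (Fintype.card F) (r + 2) 2 *
        (Fintype.card F : ℚ) ^ (r.choose 2 + (r + 2).choose 2 + (r + 2).choose 2) *
        qFactorial (Fintype.card F) (r + 2)) +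
      (Fintype.card F : ℚ)⁻¹ * (qBinomial (Fintype.card F) (r + 2) 2 *
        (Fintype.card F : ℚ) ^ (r.choose 2 + (r + 2).choose 2 + 2 * r + 1) *
          symmetricCount F (Fin r)) *
      (traceAddInvCount 2 b - (Fintype.card F - 1) * (Fintype.card F ^ 2 - 1)) := by
  have h := traceCount_mul r 2 b
  have hq1 : (1 : ℚ) < Fintype.card F := one_lt_card_rat
  have h1 := qFactorial_ne_zero hq1 r
  have hq0 : (Fintype.card F : ℚ) ≠ 0 := (zero_lt_one.trans hq1).ne'
  have hq2 : (Fintype.card F : ℚ) - 1 ≠ 0 := (sub_pos.2 hq1).ne'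
  have hq3 : (Fintype.card F : ℚ) ^ 2 - 1 ≠ 0 := (sub_pos.2 (one_lt_pow₀ hq1 two_ne_zero)).ne'
  rw [ncard_isUnit_det, ncard_isUnit_det, qFactorial_two] at h
  rw [DC2, Nat.add_sub_cancel]
  have hb : qBinomial (Fintype.card F) (r + 2) 2 =
      ((Fintype.card F : ℚ) ^ (r + 2) - 1) / (Fintype.card F ^ 2 - 1) *
        (((Fintype.card F : ℚ) ^ (r + 1) - 1) / (Fintype.card F - 1)) := by
    simp [qBinomial, Finset.prod_range_succ]
    field_simp
  have h3 : qFactorial (Fintype.card F) (r + 2) = qFactorial (Fintype.card F) r *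
      ((Fintype.card F : ℚ) ^ (r + 1) - 1) * ((Fintype.card F : ℚ) ^ (r + 2) - 1) := by
    rw [qFactorial_succ, qFactorial_succ]
  rw [← mul_left_inj' hq0, ← mul_left_inj' (mul_ne_zero h1 (mul_ne_zero hq2 hq3)), hb]
  rw [mul_right_comm, h]
  nth_rw 1 [h3]
  rw [Nat.choose_self, pow_one, mul_comm r 2]
  field_simp
  ring

variable [Algebra (ZMod 2) F]

theorem traceFormula1_of_eq (r : ℕ) {A B : ℚ}
    (hA : A = qBinomial (Fintype.card F) (r + 1) 1 *
        (Fintype.card F : ℚ) ^ (r.choose 2 + (r + 1).choose 2 + r) * symmetricCount F (Fin r))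
    (hAB : A * B = qBinomial (Fintype.card F) (r + 1) 1 *
        (Fintype.card F : ℚ) ^ (r.choose 2 + (r + 1).choose 2 + (r + 1).choose 2) *
        qFactorial (Fintype.card F) (r + 1)) :
    TraceFormula1 (F := F) (Fintype.card F) A B (traceCount (DC1 F (r + 1))) := by
  have h : ∀ b : F, (traceCount (DC1 F (r + 1)) b : ℚ) = (Fintype.card F : ℚ)⁻¹ * A * B +
      (Fintype.card F : ℚ)⁻¹ * A *
        (Fintype.card F * traceAddInvCount 1 b - (Fintype.card F - 1)) := by
    intro b
    rw [traceCount_succ, ← hA, ← hAB]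
    ring
  refine ⟨?_, fun b hb => ⟨fun ht => ?_, fun ht => ?_⟩⟩
  · rw [h, traceAddInvCount_one_zero]
    push_cast
    ring
  · have h1 := traceAddInvCount_one_of_ne_zero hb
    rw [canonicalChar_of_absTrace_eq_zero ht] at h1
    have h2 : (traceAddInvCount 1 b : ℚ) = 2 := by exact_mod_cast h1
    rw [h, h2]
    ring
  · have h1 := traceAddInvCount_one_of_ne_zero hb
    rw [canonicalChar_of_absTrace_eq_one ht] at h1
    have h2 : (traceAddInvCount 1 b : ℚ) = 0 := by
      rw [Nat.cast_eq_zero]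
      omega
    rw [h, h2]
    ring

theorem traceFormula2_of_eq (r : ℕ) {A B : ℚ}
    (hA : A = qBinomial (Fintype.card F) (r + 2) 2 *
        (Fintype.card F : ℚ) ^ (r.choose 2 + (r + 2).choose 2 + 2 * r + 1) *
          symmetricCount F (Fin r))
    (hAB : A * B = qBinomial (Fintype.card F) (r + 2) 2 *
        (Fintype.card F : ℚ) ^ (r.choose 2 + (r + 2).choose 2 + (r + 2).choose 2) *
        qFactorial (Fintype.card F) (r + 2)) :
    TraceFormula2 (F := F) (Fintype.card F) A B (traceCount (DC2 F (r + 2))) := by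
  have h : ∀ b : F, (traceCount (DC2 F (r + 2)) b : ℚ) = (Fintype.card F : ℚ)⁻¹ * A * B +
      (Fintype.card F : ℚ)⁻¹ * A *
        (traceAddInvCount 2 b - (Fintype.card F - 1) * (Fintype.card F ^ 2 - 1)) := by
    intro b
    rw [traceCount_add_two, ← hA, ← hAB]
    ring
  refine ⟨fun b hb => ?_, ?_⟩
  · have h1 := congrArg (Int.cast : ℤ → ℚ) (traceAddInvCount_two_of_ne_zero hb)
    push_cast at h1
    rw [h, h1]
    ring
  · have h1 := congrArg (Int.cast : ℤ → ℚ) (traceAddInvCount_two_zero (F := F))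
    push_cast at h1
    rw [h, h1]
    ring

end Assembly

/-! ### Identification of the constants -/

section Constants

theorem choose_two_even (k : ℕ) : (2 * k).choose 2 + k = 2 * k ^ 2 := by
  induction k with
  | zero => rfl
  | succ k ih =>
    rw [show 2 * (k + 1) = 2 * k + 1 + 1 by ring, Nat.choose_succ_succ' _ 1,
      Nat.choose_succ_succ' _ 1, Nat.choose_one_right, Nat.choose_one_right]
    linarith

theorem choose_two_odd (k : ℕ) : (2 * k + 1).choose 2 = 2 * k ^ 2 + k := by
  have := choose_two_even k
  rw [Nat.choose_succ_succ' _ 1, Nat.choose_one_right]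
  linarith

theorem choose_two_even_add_two (k : ℕ) : (2 * k + 2).choose 2 = 2 * k ^ 2 + 3 * k + 1 := by
  rw [Nat.choose_succ_succ' _ 1, choose_two_odd, Nat.choose_one_right]
  ring

theorem choose_two_odd_add_two (k : ℕ) : (2 * k + 3).choose 2 = 2 * k ^ 2 + 5 * k + 3 := by
  rw [Nat.choose_succ_succ' _ 1, choose_two_even_add_two, Nat.choose_one_right]
  ring

theorem zpow_eq_pow_of_eq {q : ℚ} {e : ℤ} {c : ℕ} (h : e = 4 * c) : q ^ (e / 4) = q ^ c := by
  rw [h, Int.mul_ediv_cancel_left _ (by norm_num), zpow_natCast]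

/-- For the exponents in `B1Minus` and `B2Plus`, which can be negative: a compensating factor `q ^
d` brings them back to natural powers. -/
theorem zpow_mul_pow_of_eq {q : ℚ} (hq : q ≠ 0) {e : ℤ} {c d : ℕ} (h : e = 4 * (c - d)) :
    q ^ (e / 4) * q ^ d = q ^ c := by
  rw [h, Int.mul_ediv_cancel_left _ (by norm_num), ← zpow_natCast, ← zpow_natCast,
    ← zpow_add₀ hq, sub_add_cancel]

variable (F : Type*) [Field F] [Fintype F]

theorem A1Plus_eq (k : ℕ) : A1Plus (2 * k + 2) (Fintype.card F) =
    qBinomial (Fintype.card F) (2 * k + 1 + 1) 1 * (Fintype.card F : ℚ) ^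
      ((2 * k + 1).choose 2 + (2 * k + 1 + 1).choose 2 + (2 * k + 1)) *
      symmetricCount F (Fin (2 * k + 1)) := by
  rw [A1Plus, zpow_eq_pow_of_eq (c := 5 * k ^ 2 + 7 * k + 2) (by push_cast; ring),
    (symmetricCount_fin k).2, show (2 * k + 2) / 2 = k + 1 by omega, choose_two_odd,
    choose_two_even_add_two]
  ring

omit [Field F] in
theorem A1Plus_mul_B1Plus (k : ℕ) :
    A1Plus (2 * k + 2) (Fintype.card F) * B1Plus (2 * k + 2) (Fintype.card F) =
    qBinomial (Fintype.card F) (2 * k + 1 + 1) 1 * (Fintype.card F : ℚ) ^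
      ((2 * k + 1).choose 2 + (2 * k + 1 + 1).choose 2 + (2 * k + 1 + 1).choose 2) *
      qFactorial (Fintype.card F) (2 * k + 1 + 1) := by
  rw [A1Plus, B1Plus, zpow_eq_pow_of_eq (c := 5 * k ^ 2 + 7 * k + 2) (by push_cast; ring),
    zpow_eq_pow_of_eq (c := k ^ 2) (by push_cast; ring),
    show (2 * k + 2) / 2 = k + 1 by omega, choose_two_odd,
    choose_two_even_add_two, show 2 * k + 1 + 1 = 2 * (k + 1) by ring, qFactorial_two_mul]
  ring

theorem A1Minus_eq (k : ℕ) : A1Minus (2 * k + 1) (Fintype.card F) =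
    qBinomial (Fintype.card F) (2 * k + 1) 1 * (Fintype.card F : ℚ) ^
      ((2 * k).choose 2 + (2 * k + 1).choose 2 + 2 * k) *
      symmetricCount F (Fin (2 * k)) := by
  have hc := choose_two_even k
  rw [A1Minus, zpow_eq_pow_of_eq (c := (2 * k).choose 2 + (2 * k + 1).choose 2 + 2 * k +
      k * (k + 1)), (symmetricCount_fin k).1, show (2 * k + 1 - 1) / 2 = k by omega]
  · ring
  · rw [choose_two_odd]
    zify at hc
    push_cast
    linear_combination -4 * hc

theorem A1Minus_mul_B1Minus (k : ℕ) :
    A1Minus (2 * k + 1) (Fintype.card F) * B1Minus (2 * k + 1) (Fintype.card F) =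
    qBinomial (Fintype.card F) (2 * k + 1) 1 * (Fintype.card F : ℚ) ^
      ((2 * k).choose 2 + (2 * k + 1).choose 2 + (2 * k + 1).choose 2) *
      qFactorial (Fintype.card F) (2 * k + 1) := by
  have hq0 : (Fintype.card F : ℚ) ≠ 0 := (zero_lt_one.trans one_lt_card_rat).ne'
  -- At `n = 2 k + 1` the exponent of `B1Minus` is `k² - 2 k`; the missing `q ^ (2 k)` is supplied
  -- by the last summand of the exponent in `A1Minus_eq`.
  have h1 := zpow_mul_pow_of_eq hq0 (c := k ^ 2) (d := 2 * k)
    (e := ((2 * k + 1 : ℕ) : ℤ) ^ 2 - 6 * ((2 * k + 1 : ℕ) : ℤ) + 5) (by push_cast; ring)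
  have h2 : (Fintype.card F : ℚ) ^ (2 * k + 1).choose 2 = (Fintype.card F : ℚ) ^ k ^ 2 *
      (Fintype.card F : ℚ) ^ (k * (k + 1)) := by
    rw [choose_two_odd, ← pow_add]; ring
  rw [← h1] at h2
  rw [A1Minus_eq, B1Minus, (symmetricCount_fin k).1, show (2 * k + 1 - 1) / 2 = k by omega,
    qFactorial_succ, qFactorial_two_mul, pow_add _ _ (2 * k),
    pow_add _ ((2 * k).choose 2 + (2 * k + 1).choose 2) ((2 * k + 1).choose 2)]
  conv_rhs => enter [1, 2, 2]; rw [h2]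
  ring

theorem A2Plus_eq (k : ℕ) : A2Plus (2 * k + 2) (Fintype.card F) =
    qBinomial (Fintype.card F) (2 * k + 2) 2 * (Fintype.card F : ℚ) ^
      ((2 * k).choose 2 + (2 * k + 2).choose 2 + 2 * (2 * k) + 1) *
      symmetricCount F (Fin (2 * k)) := by
  have hc := choose_two_even k
  rw [A2Plus, zpow_eq_pow_of_eq (c := (2 * k).choose 2 + (2 * k + 2).choose 2 + 2 * (2 * k) + 1 +
      k * (k + 1)), (symmetricCount_fin k).1, show (2 * k + 2 - 2) / 2 = k by omega]
  · ring
  · rw [choose_two_even_add_two]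
    zify at hc
    push_cast
    linear_combination -4 * hc

theorem A2Plus_mul_B2Plus (k : ℕ) :
    A2Plus (2 * k + 2) (Fintype.card F) * B2Plus (2 * k + 2) (Fintype.card F) =
    qBinomial (Fintype.card F) (2 * k + 2) 2 * (Fintype.card F : ℚ) ^
      ((2 * k).choose 2 + (2 * k + 2).choose 2 + (2 * k + 2).choose 2) *
      qFactorial (Fintype.card F) (2 * k + 2) := by
  have hq0 : (Fintype.card F : ℚ) ≠ 0 := (zero_lt_one.trans one_lt_card_rat).ne'
  -- At `n = 2 k + 2` the exponent of `B2Plus` is again `k² - 2 k`.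
  have h1 := zpow_mul_pow_of_eq hq0 (c := k ^ 2) (d := 2 * k)
    (e := ((2 * k + 2 : ℕ) : ℤ) ^ 2 - 8 * ((2 * k + 2 : ℕ) : ℤ) + 12) (by push_cast; ring)
  have h2 : (Fintype.card F : ℚ) ^ (2 * k + 2).choose 2 = (Fintype.card F : ℚ) ^ k ^ 2 *
      (Fintype.card F : ℚ) ^ (k * (k + 1) + 2 * k + 1) := by
    rw [choose_two_even_add_two, ← pow_add]; ring
  rw [← h1] at h2
  rw [A2Plus_eq, B2Plus, (symmetricCount_fin k).1, show (2 * k + 2 - 2) / 2 = k by omega,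
    show 2 * k + 2 - 1 = 2 * k + 1 by omega, qFactorial_succ, qFactorial_succ, qFactorial_two_mul,
    add_assoc _ (2 * (2 * k)), pow_add _ _ (2 * (2 * k) + 1),
    pow_add _ ((2 * k).choose 2 + (2 * k + 2).choose 2) ((2 * k + 2).choose 2)]
  conv_rhs => enter [1, 2, 2]; rw [h2]
  ring

theorem A2Minus_eq (k : ℕ) : A2Minus (2 * k + 3) (Fintype.card F) =
    qBinomial (Fintype.card F) (2 * k + 1 + 2) 2 * (Fintype.card F : ℚ) ^
      ((2 * k + 1).choose 2 + (2 * k + 1 + 2).choose 2 + 2 * (2 * k + 1) + 1) *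
      symmetricCount F (Fin (2 * k + 1)) := by
  rw [A2Minus, zpow_eq_pow_of_eq (c := 5 * k ^ 2 + 11 * k + 6) (by push_cast; ring),
    (symmetricCount_fin k).2, show (2 * k + 3 - 1) / 2 = k + 1 by omega, choose_two_odd,
    choose_two_odd_add_two]
  ring

omit [Field F] in
theorem A2Minus_mul_B2Minus (k : ℕ) :
    A2Minus (2 * k + 3) (Fintype.card F) * B2Minus (2 * k + 3) (Fintype.card F) =
    qBinomial (Fintype.card F) (2 * k + 1 + 2) 2 * (Fintype.card F : ℚ) ^
      ((2 * k + 1).choose 2 + (2 * k + 1 + 2).choose 2 + (2 * k + 1 + 2).choose 2) *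
      qFactorial (Fintype.card F) (2 * k + 1 + 2) := by
  rw [A2Minus, B2Minus, zpow_eq_pow_of_eq (c := 5 * k ^ 2 + 11 * k + 6) (by push_cast; ring),
    zpow_eq_pow_of_eq (c := k ^ 2) (by push_cast; ring),
    show (2 * k + 3 - 1) / 2 = k + 1 by omega, choose_two_odd,
    choose_two_odd_add_two, show 2 * k + 1 + 2 = 2 * (k + 1) + 1 by ring, qFactorial_succ,
    qFactorial_two_mul]
  ring

end Constants

theorem proposition9 {F : Type*} [Field F] [Fintype F] [Algebra (ZMod 2) F]
    (q : ℚ) (hq : q = Fintype.card F) (n : ℕ) :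
    (Even n → 2 ≤ n →
      TraceFormula1 q (A1Plus n q) (B1Plus n q) (traceCount (DC1 F n)) ∧
      TraceFormula2 q (A2Plus n q) (B2Plus n q) (traceCount (DC2 F n))) ∧
    (Odd n → 1 ≤ n →
      TraceFormula1 q (A1Minus n q) (B1Minus n q) (traceCount (DC1 F n))) ∧
    (Odd n → 3 ≤ n →
      TraceFormula2 q (A2Minus n q) (B2Minus n q) (traceCount (DC2 F n))) := by
  subst hq
  refine ⟨fun hn h2 => ?_, fun hn _ => ?_, fun hn h3 => ?_⟩
  · obtain ⟨k, rfl⟩ : ∃ k, n = 2 * k + 2 := by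
      obtain ⟨j, rfl⟩ := hn
      exact ⟨j - 1, by omega⟩
    exact ⟨traceFormula1_of_eq (2 * k + 1) (A1Plus_eq F k) (A1Plus_mul_B1Plus F k),
      traceFormula2_of_eq (2 * k) (A2Plus_eq F k) (A2Plus_mul_B2Plus F k)⟩
  · obtain ⟨k, rfl⟩ := hn
    exact traceFormula1_of_eq (2 * k) (A1Minus_eq F k) (A1Minus_mul_B1Minus F k)
  · obtain ⟨k, rfl⟩ : ∃ k, n = 2 * k + 3 := by
      obtain ⟨j, rfl⟩ := hn
      exact ⟨j - 1, by omega⟩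
    exact traceFormula2_of_eq (2 * k + 1) (A2Minus_eq F k) (A2Minus_mul_B2Minus F k)
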